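/- Let $G\subseteq GL(n,\mathbb R)$ be a compact connected linear group with an invariant scalar product $\langle\cdot,\cdot\rangle$ on $\mathbb R^n$ and Lie algebra $\mathcal G$. Let $s$ be the maximal orbit dimension of $G$, assume $s\ge 1$ (i.e. $G$ is nontrivial), and let $B_1,\dots,B_s\in\mathcal G$ be such that $B_1z,\dots,B_sz$ are linearly independent for some $z\in\mathbb R^n$. Let $\sigma_1,\dots,\sigma_{n-s}$ be algebraically independent $G$-invariant polynomials, with gradients $q_j$ defined by $D\sigma_j(x)y=\langle q_j(x),y\rangle$, and put $$\theta(x)=\det\bigl(B_1x,\dots,B_sx,q_1(x),\dots,q_{n-s}(x)\bigr).$$ Let $\Psi=(\tau_1,\dots,\tau_r)$, where $\tau_1,\dots,\tau_r$ generate the algebra of $G$-invariant polynomials. Let $f$ be an analytic vector field on an open set $U\subseteq\mathbb R^n$, written as $$f(x)=\sum_i\alpha_i(x)B_ix+\sum_j\beta_j(x)q_j(x)\qquad\text{on }\widetilde U=\{x\in U:\theta(x)\neq0\},$$ and let $\hat f=\sum_j\beta_jq_j$. Let $V$ be any nonempty open subset of $\widetilde U$ (for instance $V=\widetilde U$). Terminology,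 for a vector field $F$ on $V$: * A function $\varphi$ on $V$ is $G$-invariant if $\varphi(gx)=\varphi(x)$ whenever $g\in G$ and $x,gx\in V$. * $F$ is reducible on $V$ by the invariants of $G$ if $\Psi$ sends parameterized solutions of $\dot x=F(x)$ in $V$ to parameterized solutions of some analytic equation $\dot y=h(y)$ on an open neighbourhood of $\Psi(V)$, and there is an integer $m$ with $0<m<n$ such that $D\Psi$ has rank $\le m$ on $V$, with equality at some point. * $F$ is orbitally reducible on $V$ by the invariants of $G$ if $\mu F$ is reducible on $V$ by the invariants of $G$ for some analytic $\mu$ without zeros on $V$. * $F$ is $G$-symmetric on $V$ if every $g\in G$ sends parameterized solutions of $\dot x=F(x)$ in $V$ to parameterized solutions, as long as the image stays in $V$. * $F$ is orbitally $\mathcal G$-symmetric on $V$ if for every $B\in\mathcal G$ there is an analytic function $a_B$ on $V$ with $[B,F]=a_BF$ on $V$, where $B$ also denotes the vector field $x\mapsto Bx$. * Analytic vector fields $g_1,\dots,g_s$ form an involution system on $V$ if $[g_i,g_j]=\sum_kc_{ijk}g_k$ with analytic functions $c_{ijk}$ on $V$. Then the following hold. **(a)** $f$ is reducible on $V$ by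 the invariants of $G$ if and only if all $\beta_j$ are $G$-invariant on $V$, and this is the case if and only if $\hat f$ is $G$-symmetric on $V$. Thus every reducible system is obtained from a symmetric one: if $f$ is reducible on $V$ by the invariants of $G$, then the vector fields $B_ix$ form an involution system on $V$, and there are a $G$-symmetric analytic vector field $F$ and analytic functions $\mu_i$ on $V$ with $[F,B_i]=0$ for all $i$ and $f(x)=F(x)+\sum_i\mu_i(x)B_ix$. **(b)** $f$ is orbitally reducible on $V$ by the invariants of $G$ if and only if > $(\ast)_V$: there are an analytic function $\nu$ without zeros on $V$ and analytic $G$-invariant functions $\widetilde\beta_j$ on $V$ such that $\beta_j=\nu\,\widetilde\beta_j$ on $V$ for all $j$. Condition $(\ast)_V$ implies that $\hat f$ is orbitally $\mathcal G$-symmetric on $V$. The converse holds on $V$ if $gV\subseteq V$ for all $g\in G$, and it holds locally for every $V$: the vector field $\hat f$ is orbitally $\mathcal G$-symmetric on $V$ if and only if every point of $V$ has an open neighbourhood $W\subseteq V$ with $(\ast)_W$, equivalently, if and only if every point of $V$ has an open neighbourhood $W\subseteq V$ on which $f$ is orbitally reducible by the invariants of $G$. Thus every orbitally reducible system is obtained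 from an orbitally symmetric one: if $f$ is orbitally reducible on $V$ by the invariants of $G$, then the vector fields $B_ix$ form an involution system on $V$, and there are an orbitally $\mathcal G$-symmetric analytic vector field $F$ and analytic functions $a_i,\mu_i$ on $V$ with $[F,B_i]=a_iF$ for all $i$ and $f(x)=F(x)+\sum_i\mu_i(x)B_ix$. -/

import Mathlib

open Matrix

noncomputable section

namespace OrbitalReduction

/-- The polynomial function on `ℝⁿ` given by `p`. -/
def polyFun {n : ℕ} (p : MvPolynomial (Fin n) ℝ) (x : Fin n → ℝ) : ℝ :=
  MvPolynomial.eval x p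

/-- The linear vector field `x ↦ B x`. -/
def linField {n : ℕ} (B : Matrix (Fin n) (Fin n) ℝ) (x : Fin n → ℝ) : Fin n → ℝ :=
  B *ᵥ x

/-! ### Linear groups -/

/-- The Lie algebra of a closed linear group `G`: all `B` with `exp (t B) ∈ G` for all real `t`. -/
def lieAlg {n : ℕ} (G : Subgroup (GL (Fin n) ℝ)) : Set (Matrix (Fin n) (Fin n) ℝ) :=
  {B | ∀ t : ℝ, ∃ g ∈ G, (g : Matrix (Fin n) (Fin n) ℝ) = NormedSpace.exp (t • B)}

/-- The dimension of the orbit of `G` through `z`, i.e. of its tangent space `{B z : B ∈ Lie G}`. -/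
def orbitDim {n : ℕ} (G : Subgroup (GL (Fin n) ℝ)) (z : Fin n → ℝ) : ℕ :=
  Module.finrank ℝ (Submodule.span ℝ ((fun B => linField B z) '' lieAlg G))

/-- The algebra of `G`-invariant polynomials. -/
def invariantAlgebra {n : ℕ} (G : Subgroup (GL (Fin n) ℝ)) :
    Subalgebra ℝ (MvPolynomial (Fin n) ℝ) where
  carrier := {p | ∀ g ∈ G, ∀ x : Fin n → ℝ,
    polyFun p ((g : Matrix (Fin n) (Fin n) ℝ) *ᵥ x) = polyFun p x}
  mul_mem' := by
    intro p q hp hq g hg x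
    have h1 := hp g hg x
    have h2 := hq g hg x
    simp only [polyFun, map_mul] at *
    rw [h1, h2]
  add_mem' := by
    intro p q hp hq g hg x
    have h1 := hp g hg x
    have h2 := hq g hg x
    simp only [polyFun, map_add] at *
    rw [h1, h2]
  algebraMap_mem' := by
    intro c g _ x
    simp [polyFun]

/-- `S` is the Gram matrix of a `G`-invariant scalar product `⟨x, y⟩ = x ⬝ᵥ S *ᵥ y`. -/
def IsInvariantScalarProduct {n : ℕ} (G : Subgroup (GL (Fin n) ℝ))
    (S : Matrix (Fin n) (Fin n) ℝ) : Prop :=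
  S.PosDef ∧ ∀ g ∈ G, ∀ x y : Fin n → ℝ,
    ((g : Matrix (Fin n) (Fin n) ℝ) *ᵥ x) ⬝ᵥ (S *ᵥ ((g : Matrix (Fin n) (Fin n) ℝ) *ᵥ y)) =
      x ⬝ᵥ (S *ᵥ y)

/-- The gradient of the polynomial `p` for the scalar product `x ⬝ᵥ S *ᵥ y`
(see `gradField_spec` for its defining property). -/
def gradField {n : ℕ} (S : Matrix (Fin n) (Fin n) ℝ) (p : MvPolynomial (Fin n) ℝ)
    (x : Fin n → ℝ) : Fin n → ℝ :=
  S⁻¹ *ᵥ fun i => polyFun (MvPolynomial.pderiv i p) x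

theorem polyFun_hasFDerivAt {n : ℕ} (p : MvPolynomial (Fin n) ℝ) (x : Fin n → ℝ) :
    HasFDerivAt (polyFun p)
      (∑ i, polyFun (MvPolynomial.pderiv i p) x •
        ContinuousLinearMap.proj (R := ℝ) (φ := fun _ : Fin n => ℝ) i) x := by
  induction p using MvPolynomial.induction_on with
  | C a =>
    have h : polyFun (MvPolynomial.C a : MvPolynomial (Fin n) ℝ) = fun _ => a := by
      funext z; simp [polyFun]
    rw [h]
    have h0 : (∑ i, polyFun (MvPolynomial.pderiv i (MvPolynomial.C a : MvPolynomial (Fin n) ℝ)) x •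
        ContinuousLinearMap.proj (R := ℝ) (φ := fun _ : Fin n => ℝ) i) = 0 := by
      simp [polyFun]
    rw [h0]
    exact hasFDerivAt_const a x
  | add p q hp hq =>
    have h : polyFun (p + q) = fun z => polyFun p z + polyFun q z := by
      funext z; simp [polyFun]
    rw [h]
    refine (hp.add hq).congr_fderiv ?_
    simp [polyFun, add_smul, Finset.sum_add_distrib]
  | mul_X p k hp =>
    have h : polyFun (p * MvPolynomial.X k) = fun z => polyFun p z * z k := by
      funext z; simp [polyFun]
    rw [h]
    have hk : HasFDerivAt (fun z : Fin n → ℝ => z k)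
        (ContinuousLinearMap.proj (R := ℝ) (φ := fun _ : Fin n => ℝ) k) x :=
      (ContinuousLinearMap.proj (R := ℝ) (φ := fun _ : Fin n => ℝ) k).hasFDerivAt
    refine (hp.mul hk).congr_fderiv ?_
    ext y
    simp only [polyFun, Derivation.leibniz, MvPolynomial.pderiv_X, smul_eq_mul, map_add, map_mul,
      MvPolynomial.eval_X, add_smul, Finset.sum_add_distrib, Pi.single_apply, apply_ite,
      map_zero, mul_one, mul_zero, ite_smul, zero_smul, Finset.sum_ite_eq,
      Finset.mem_univ, if_true, Finset.smul_sum, smul_smul]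

/-- The defining property of the gradient: `Dp(x) y = ⟨q(x), y⟩`. -/
theorem gradField_spec {n : ℕ} {S : Matrix (Fin n) (Fin n) ℝ} (hS : S.PosDef)
    (p : MvPolynomial (Fin n) ℝ) (x y : Fin n → ℝ) :
    fderiv ℝ (polyFun p) x y = gradField S p x ⬝ᵥ (S *ᵥ y) := by
  have hu : IsUnit S.det := (Matrix.isUnit_iff_isUnit_det S).1 hS.isUnit
  have hT : Sᵀ = S := by simpa using hS.isHermitian.eq
  rw [(polyFun_hasFDerivAt p x).fderiv, Matrix.dotProduct_mulVec, ← Matrix.mulVec_transpose, hT,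
    gradField, Matrix.mulVec_mulVec, Matrix.mul_nonsing_inv S hu, Matrix.one_mulVec]
  simp [dotProduct]

/-- `θ(x) = det (B₁ x, …, B_s x, q₁(x), …, q_{n-s}(x))`, with `q_j` the gradient of `σ_j`. -/
def theta {n s : ℕ} (S : Matrix (Fin n) (Fin n) ℝ) (B : Fin s → Matrix (Fin n) (Fin n) ℝ)
    (σ : Fin (n - s) → MvPolynomial (Fin n) ℝ) (x : Fin n → ℝ) : ℝ :=
  Matrix.det (Matrix.of fun i c : Fin n =>
    if h : c.1 < s then linField (B ⟨c.1, h⟩) x i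
    else gradField S (σ ⟨c.1 - s, by omega⟩) x i)

/-- `φ` is `G`-invariant on `V` (which need not be a `G`-stable set). -/
def InvariantOn {n : ℕ} (G : Subgroup (GL (Fin n) ℝ)) (V : Set (Fin n → ℝ))
    (φ : (Fin n → ℝ) → ℝ) : Prop :=
  ∀ g ∈ G, ∀ x ∈ V, (g : Matrix (Fin n) (Fin n) ℝ) *ᵥ x ∈ V →
    φ ((g : Matrix (Fin n) (Fin n) ℝ) *ᵥ x) = φ x

/-- `V` is mapped into itself by all elements of `G`. -/
def StableSet {n : ℕ} (G : Subgroup (GL (Fin n) ℝ)) (V : Set (Fin n → ℝ)) : Prop :=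
  ∀ g ∈ G, ∀ x ∈ V, (g : Matrix (Fin n) (Fin n) ℝ) *ᵥ x ∈ V

/-! ### Solutions, symmetries, reducibility -/

/-- `γ` is a solution of `ẋ = f(x)` in `V` on the open interval `I`. -/
def IsSolution {n : ℕ} (f : (Fin n → ℝ) → (Fin n → ℝ)) (V : Set (Fin n → ℝ))
    (I : Set ℝ) (γ : ℝ → (Fin n → ℝ)) : Prop :=
  IsOpen I ∧ I.OrdConnected ∧ ∀ t ∈ I, γ t ∈ V ∧ HasDerivAt γ (f (γ t)) t

/-- `Φ` sends parameterized solutions of `ẋ = f(x)` in `V` (as far as their image lies in `W`) to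
parameterized solutions of `ẏ = h(y)` in `W`. -/
def MapsSolutions {n r : ℕ} (Φ : (Fin n → ℝ) → (Fin r → ℝ))
    (f : (Fin n → ℝ) → (Fin n → ℝ)) (V : Set (Fin n → ℝ))
    (h : (Fin r → ℝ) → (Fin r → ℝ)) (W : Set (Fin r → ℝ)) : Prop :=
  ∀ (I : Set ℝ) (γ : ℝ → (Fin n → ℝ)), IsSolution f V I γ → (∀ t ∈ I, Φ (γ t) ∈ W) →
    IsSolution h W I (fun t => Φ (γ t))

/-- Every transformation in `G` is a symmetry of `ẋ = f(x)` on `V`. -/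
def SymmetricOn {n : ℕ} (G : Subgroup (GL (Fin n) ℝ)) (V : Set (Fin n → ℝ))
    (f : (Fin n → ℝ) → (Fin n → ℝ)) : Prop :=
  ∀ g ∈ G, MapsSolutions (linField (g : Matrix (Fin n) (Fin n) ℝ)) f V f V

/-- `ẋ = f(x)` is orbitally symmetric on `V` with respect to the Lie algebra of `G`:
`[B, f] = a_B f` with analytic scalar functions `a_B`. -/
def OrbitallySymmetricOn {n : ℕ} (G : Subgroup (GL (Fin n) ℝ)) (V : Set (Fin n → ℝ))
    (f : (Fin n → ℝ) → (Fin n → ℝ)) : Prop :=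
  ∀ B ∈ lieAlg G, ∃ a : (Fin n → ℝ) → ℝ, AnalyticOnNhd ℝ a V ∧
    ∀ x ∈ V, VectorField.lieBracket ℝ (linField B) f x = a x • f x

/-- `ẋ = f(x)` is reducible on `V` by the map `Ψ`. -/
def ReducibleBy {n r : ℕ} (Ψ : (Fin n → ℝ) → (Fin r → ℝ))
    (f : (Fin n → ℝ) → (Fin n → ℝ)) (V : Set (Fin n → ℝ)) : Prop :=
  AnalyticOnNhd ℝ Ψ V ∧
  (∃ m : ℕ, 0 < m ∧ m < n ∧
    (∀ x ∈ V, Module.finrank ℝ (LinearMap.range (fderiv ℝ Ψ x).toLinearMap) ≤ m) ∧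
    ∃ x ∈ V, Module.finrank ℝ (LinearMap.range (fderiv ℝ Ψ x).toLinearMap) = m) ∧
  ∃ (W : Set (Fin r → ℝ)) (h : (Fin r → ℝ) → (Fin r → ℝ)),
    IsOpen W ∧ Set.MapsTo Ψ V W ∧ AnalyticOnNhd ℝ h W ∧ MapsSolutions Ψ f V h W

/-- `ẋ = f(x)` is orbitally reducible on `V` by the map `Ψ`: some equation `ẋ = μ(x) f(x)`, with
`μ` analytic and without zeros on `V`, is reducible on `V` by `Ψ`. -/
def OrbitallyReducibleBy {n r : ℕ} (Ψ : (Fin n → ℝ) → (Fin r → ℝ))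
    (f : (Fin n → ℝ) → (Fin n → ℝ)) (V : Set (Fin n → ℝ)) : Prop :=
  ∃ μ : (Fin n → ℝ) → ℝ, AnalyticOnNhd ℝ μ V ∧ (∀ x ∈ V, μ x ≠ 0) ∧
    ReducibleBy Ψ (fun x => μ x • f x) V

/-- The map `(τ₁, …, τ_r)` given by polynomials. -/
def polyMap {n r : ℕ} (τ : Fin r → MvPolynomial (Fin n) ℝ) (x : Fin n → ℝ) : Fin r → ℝ :=
  fun l => polyFun (τ l) x

/-- `β_j = ν · β̃_j` on `V`, with `ν` analytic and without zeros and all `β̃_j` analytic and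
`G`-invariant. -/
def InvariantUpToFactorOn {n k : ℕ} (G : Subgroup (GL (Fin n) ℝ)) (V : Set (Fin n → ℝ))
    (β : Fin k → (Fin n → ℝ) → ℝ) : Prop :=
  ∃ (ν : (Fin n → ℝ) → ℝ) (β' : Fin k → (Fin n → ℝ) → ℝ),
    AnalyticOnNhd ℝ ν V ∧ (∀ x ∈ V, ν x ≠ 0) ∧
    ∀ j, AnalyticOnNhd ℝ (β' j) V ∧ InvariantOn G V (β' j) ∧ ∀ x ∈ V, β j x = ν x * β' j x

/-- The analytic vector fields `g₁, …, g_s` form an involution system on `V`. -/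
def InvolutionSystemOn {n s : ℕ} (g : Fin s → (Fin n → ℝ) → (Fin n → ℝ))
    (V : Set (Fin n → ℝ)) : Prop :=
  (∀ i, AnalyticOnNhd ℝ (g i) V) ∧
  ∃ c : Fin s → Fin s → Fin s → (Fin n → ℝ) → ℝ,
    (∀ i j k, AnalyticOnNhd ℝ (c i j k) V) ∧
    ∀ i j, ∀ x ∈ V, VectorField.lieBracket ℝ (g i) (g j) x = ∑ k, c i j k x • g k x

end OrbitalReduction

end

noncomputable section

namespace OrbitalReduction

open Topology Filter MeasureTheory
open scoped ENNReal NNReal BoundedContinuousFunction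

/-! ### Infinitesimal action of the group: invariant functions, equivariant gradients, orthogonality
to the orbits. -/

section

variable {n : ℕ}

/-! Where `theta` does not vanish, the fields `B i` span the orbit directions and the gradients of
the `σ j` span their orthogonal complement. The gradients are equivariant, so `f` splits into an
orbit part, which no invariant sees, and `gradPart`, whose symmetry is governed by the scalar
functions `β j` alone.

For (a), a reduced field exists exactly when `DΨ · f` is an analytic function of `Ψ`. If it exists,
comparing `x` with `g x` forces every `β j` to be invariant, since the Gram matrix of the gradients
is invertible. Conversely, invariant `β j` make `DΨ · f` analytic and invariant, and such a function
factors analytically through `Ψ` (`exists_analytic_factor`). Locally the factor is obtained from an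
analytic section of `σ`. The local factors agree because the polynomial invariants of a compact
group separate orbits (`exists_mem_of_polyMap_eq`) and because, near `Ψ x`, the values of `σ`
already determine those of `Ψ` (`exists_local_section`). This works although `V` need not be
`G`-stable.

For (b), the first equivalence is (a) applied to `μ f`. Since the gradients commute with the fields
of the Lie algebra, orbital symmetry of `gradPart` says that all `β j` satisfy the same equations `B
β_j = a_B β_j`. Along the fibres of `σ` in a chart this is a scalar linear differential equation, so
all `β j` grow by one common exponential factor (`exists_transport`); dividing by it leaves
functions of `σ` (`exists_local_factor`). The local condition conversely yields orbital symmetry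
because the local functions `a_B` can be glued (`orbitallySymmetricOn_of_local`).

On a stable `V` the local factors become multipliers `χ` with `β_j (g x) = χ g x * β_j x`.
Connectedness of `G` extends them from `g` near the identity to all `g` (`exists_hasMultiplier`).
They satisfy the cocycle identity where the `β j` do not all vanish, and the Haar average of `χ g⁻¹
x` provides the global factor (`invariantUpToFactorOn_of_multipliers`). Its analyticity comes from a
theorem on parametric integrals, `analyticAt_setIntegral`. -/

theorem hasDerivAt_exp_mulVec (B : Matrix (Fin n) (Fin n) ℝ) (x : Fin n → ℝ) :
    HasDerivAt (fun t : ℝ => NormedSpace.exp (t • B) *ᵥ x) (B *ᵥ x) 0 := by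
  let _ : NormedRing (Matrix (Fin n) (Fin n) ℝ) := Matrix.linftyOpNormedRing
  let _ : NormedAlgebra ℝ (Matrix (Fin n) (Fin n) ℝ) := Matrix.linftyOpNormedAlgebra
  have h : HasDerivAt (fun t : ℝ => NormedSpace.exp (t • B)) B 0 := by
    have h0 := hasDerivAt_exp_smul_const' (𝕂 := ℝ) B (0 : ℝ)
    simp only [zero_smul, NormedSpace.exp_zero, mul_one] at h0
    exact h0
  let L : Matrix (Fin n) (Fin n) ℝ →ₗ[ℝ] (Fin n → ℝ) :=
    { toFun := fun M => M *ᵥ x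
      map_add' := fun M N => Matrix.add_mulVec M N x
      map_smul' := fun c M => Matrix.smul_mulVec c M x }
  exact (L.toContinuousLinearMap.hasFDerivAt (x := NormedSpace.exp ((0 : ℝ) • B))).comp_hasDerivAt
    (0 : ℝ) h

theorem exp_zero_smul_mulVec (B : Matrix (Fin n) (Fin n) ℝ) (x : Fin n → ℝ) :
    NormedSpace.exp ((0 : ℝ) • B) *ᵥ x = x := by
  simp

/-- Derivative of a function along the one-parameter group generated by `B`. -/
theorem hasDerivAt_comp_exp {E : Type*} [NormedAddCommGroup E] [NormedSpace ℝ E]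
    {φ : (Fin n → ℝ) → E} {x : Fin n → ℝ} (hφ : DifferentiableAt ℝ φ x)
    (B : Matrix (Fin n) (Fin n) ℝ) :
    HasDerivAt (fun t : ℝ => φ (NormedSpace.exp (t • B) *ᵥ x)) (fderiv ℝ φ x (linField B x)) 0 := by
  have h1 : HasFDerivAt φ (fderiv ℝ φ x) (NormedSpace.exp ((0 : ℝ) • B) *ᵥ x) := by
    rw [exp_zero_smul_mulVec]; exact hφ.hasFDerivAt
  exact h1.comp_hasDerivAt (0 : ℝ) (hasDerivAt_exp_mulVec B x)

variable {G : Subgroup (GL (Fin n) ℝ)}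

theorem InvariantOn.fderiv_eq_zero {V : Set (Fin n → ℝ)} (hV : IsOpen V)
    {φ : (Fin n → ℝ) → ℝ} (hφ : InvariantOn G V φ) {B : Matrix (Fin n) (Fin n) ℝ}
    (hB : B ∈ lieAlg G) {x : Fin n → ℝ} (hx : x ∈ V) (hd : DifferentiableAt ℝ φ x) :
    fderiv ℝ φ x (linField B x) = 0 := by
  have h1 := hasDerivAt_comp_exp hd B
  have hc : ContinuousAt (fun t : ℝ => NormedSpace.exp (t • B) *ᵥ x) 0 :=
    (hasDerivAt_exp_mulVec B x).continuousAt
  have hev : ∀ᶠ t in 𝓝 (0 : ℝ), NormedSpace.exp (t • B) *ᵥ x ∈ V :=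
    hc.eventually_mem (by rw [exp_zero_smul_mulVec]; exact hV.mem_nhds hx)
  have h2 : (fun t : ℝ => φ (NormedSpace.exp (t • B) *ᵥ x)) =ᶠ[𝓝 0] fun _ => φ x := by
    filter_upwards [hev] with t ht
    obtain ⟨g, hg, hge⟩ := hB t
    rw [← hge] at ht ⊢
    exact hφ g hg x hx ht
  exact h1.unique ((hasDerivAt_const (0 : ℝ) (φ x)).congr_of_eventuallyEq h2)

theorem invariantOn_polyFun {p : MvPolynomial (Fin n) ℝ} (hp : p ∈ invariantAlgebra G)
    (V : Set (Fin n → ℝ)) : InvariantOn G V (polyFun p) :=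
  fun g hg x _ _ => hp g hg x

theorem analyticAt_polyFun (p : MvPolynomial (Fin n) ℝ) (x : Fin n → ℝ) :
    AnalyticAt ℝ (polyFun p) x :=
  AnalyticOnNhd.eval_mvPolynomial p x (Set.mem_univ _)

theorem analyticAt_linField (B : Matrix (Fin n) (Fin n) ℝ) (x : Fin n → ℝ) :
    AnalyticAt ℝ (linField B) x :=
  (LinearMap.toContinuousLinearMap (Matrix.mulVecLin B)).analyticAt x

theorem fderiv_linField (B : Matrix (Fin n) (Fin n) ℝ) (x v : Fin n → ℝ) :
    fderiv ℝ (linField B) x v = B *ᵥ v := by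
  have h : HasFDerivAt (linField B) (LinearMap.toContinuousLinearMap (Matrix.mulVecLin B)) x :=
    (LinearMap.toContinuousLinearMap (Matrix.mulVecLin B)).hasFDerivAt
  rw [h.fderiv]; rfl

theorem analyticAt_gradField (S : Matrix (Fin n) (Fin n) ℝ) (p : MvPolynomial (Fin n) ℝ)
    (x : Fin n → ℝ) : AnalyticAt ℝ (gradField S p) x := by
  have h : AnalyticAt ℝ (fun x => fun i => polyFun (MvPolynomial.pderiv i p) x) x :=
    AnalyticAt.pi fun i => analyticAt_polyFun _ x
  exact (analyticAt_linField S⁻¹ _).comp h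

variable {S : Matrix (Fin n) (Fin n) ℝ}

theorem eq_of_forall_dotProduct_mulVec (hS : S.PosDef) {u v : Fin n → ℝ}
    (h : ∀ y, u ⬝ᵥ (S *ᵥ y) = v ⬝ᵥ (S *ᵥ y)) : u = v := by
  have h0 : (u - v) ⬝ᵥ (S *ᵥ (u - v)) = 0 := by
    rw [sub_dotProduct, h, sub_self]
  by_contra hne
  have := hS.dotProduct_mulVec_pos (sub_ne_zero.2 hne)
  simp only [star_trivial] at this
  exact this.ne' h0

theorem gradField_orthogonal (hS : S.PosDef) {p : MvPolynomial (Fin n) ℝ}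
    (hp : p ∈ invariantAlgebra G) {B : Matrix (Fin n) (Fin n) ℝ} (hB : B ∈ lieAlg G)
    (x : Fin n → ℝ) : gradField S p x ⬝ᵥ (S *ᵥ linField B x) = 0 := by
  rw [← gradField_spec hS]
  exact (invariantOn_polyFun hp Set.univ).fderiv_eq_zero isOpen_univ hB (Set.mem_univ _)
    (analyticAt_polyFun p x).differentiableAt

/-- Differentiating `p (g x) = p x` gives equality of the two sides when tested against vectors `g
y`. These are all vectors, and `g` preserves the scalar product. -/
theorem gradField_equivariant (hS : IsInvariantScalarProduct G S) {p : MvPolynomial (Fin n) ℝ}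
    (hp : p ∈ invariantAlgebra G) {g : GL (Fin n) ℝ} (hg : g ∈ G) (x : Fin n → ℝ) :
    gradField S p ((g : Matrix (Fin n) (Fin n) ℝ) *ᵥ x) =
      (g : Matrix (Fin n) (Fin n) ℝ) *ᵥ gradField S p x := by
  have key : ∀ y, gradField S p ((g : Matrix (Fin n) (Fin n) ℝ) *ᵥ x) ⬝ᵥ
      (S *ᵥ ((g : Matrix (Fin n) (Fin n) ℝ) *ᵥ y)) = gradField S p x ⬝ᵥ (S *ᵥ y) := by
    intro y
    rw [← gradField_spec hS.1, ← gradField_spec hS.1]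
    have h1 : HasFDerivAt (linField (g : Matrix (Fin n) (Fin n) ℝ))
        (LinearMap.toContinuousLinearMap (Matrix.mulVecLin (g : Matrix (Fin n) (Fin n) ℝ))) x :=
      (LinearMap.toContinuousLinearMap
        (Matrix.mulVecLin (g : Matrix (Fin n) (Fin n) ℝ))).hasFDerivAt
    have h2 := ((analyticAt_polyFun p
      (linField (g : Matrix (Fin n) (Fin n) ℝ) x)).differentiableAt.hasFDerivAt).comp x h1
    have h3 : polyFun p ∘ linField (g : Matrix (Fin n) (Fin n) ℝ) = polyFun p :=
      funext fun z => hp g hg z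
    rw [h3] at h2
    rw [h2.fderiv]; rfl
  refine eq_of_forall_dotProduct_mulVec hS.1 fun y => ?_
  have hy : y = (g : Matrix (Fin n) (Fin n) ℝ) *ᵥ
      (((g⁻¹ : GL (Fin n) ℝ) : Matrix (Fin n) (Fin n) ℝ) *ᵥ y) := by
    rw [Matrix.mulVec_mulVec, ← Units.val_mul]; simp
  rw [hy, key, hS.2 g hg]

theorem fderiv_gradField_linField (hS : IsInvariantScalarProduct G S)
    {p : MvPolynomial (Fin n) ℝ} (hp : p ∈ invariantAlgebra G)
    {B : Matrix (Fin n) (Fin n) ℝ} (hB : B ∈ lieAlg G) (x : Fin n → ℝ) :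
    fderiv ℝ (gradField S p) x (linField B x) = B *ᵥ gradField S p x := by
  have h1 := hasDerivAt_comp_exp (analyticAt_gradField S p x).differentiableAt B
  have h2 := hasDerivAt_exp_mulVec B (gradField S p x)
  have h3 : (fun t : ℝ => gradField S p (NormedSpace.exp (t • B) *ᵥ x)) =
      fun t : ℝ => NormedSpace.exp (t • B) *ᵥ gradField S p x := by
    funext t
    obtain ⟨g, hg, hge⟩ := hB t
    rw [← hge]; exact gradField_equivariant hS hp hg x
  rw [h3] at h1
  exact h1.unique h2

theorem hasDerivAt_dotProduct_mulVec (S : Matrix (Fin n) (Fin n) ℝ) {u v : ℝ → Fin n → ℝ}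
    {u' v' : Fin n → ℝ} {t : ℝ} (hu : HasDerivAt u u' t) (hv : HasDerivAt v v' t) :
    HasDerivAt (fun t => u t ⬝ᵥ (S *ᵥ v t)) (u' ⬝ᵥ (S *ᵥ v t) + u t ⬝ᵥ (S *ᵥ v')) t := by
  have hSv : HasDerivAt (fun t => S *ᵥ v t) (S *ᵥ v') t :=
    (LinearMap.toContinuousLinearMap (Matrix.mulVecLin S)).hasFDerivAt.comp_hasDerivAt t hv
  rw [hasDerivAt_pi] at hu hSv
  simp only [dotProduct, ← Finset.sum_add_distrib]
  exact HasDerivAt.fun_sum fun i _ => (hu i).mul (hSv i)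

theorem lieAlg_skew (hS : IsInvariantScalarProduct G S) {B : Matrix (Fin n) (Fin n) ℝ}
    (hB : B ∈ lieAlg G) (x y : Fin n → ℝ) :
    (B *ᵥ x) ⬝ᵥ (S *ᵥ y) + x ⬝ᵥ (S *ᵥ (B *ᵥ y)) = 0 := by
  have h := hasDerivAt_dotProduct_mulVec S (hasDerivAt_exp_mulVec B x) (hasDerivAt_exp_mulVec B y)
  have h3 : (fun t : ℝ => (NormedSpace.exp (t • B) *ᵥ x) ⬝ᵥ (S *ᵥ (NormedSpace.exp (t • B) *ᵥ y))) =
      fun t : ℝ => x ⬝ᵥ (S *ᵥ y) := by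
    funext t
    obtain ⟨g, hg, hge⟩ := hB t
    rw [← hge]; exact hS.2 g hg x y
  rw [h3, exp_zero_smul_mulVec, exp_zero_smul_mulVec] at h
  exact h.unique (hasDerivAt_const _ _)

/-- The fields generated by the Lie algebra are orthogonal to the position vector. -/
theorem linField_orthogonal_self (hS : IsInvariantScalarProduct G S)
    {B : Matrix (Fin n) (Fin n) ℝ} (hB : B ∈ lieAlg G) (x : Fin n → ℝ) :
    x ⬝ᵥ (S *ᵥ linField B x) = 0 := by
  have h := lieAlg_skew hS hB x x
  have hT : Sᵀ = S := by simpa using hS.1.isHermitian.eq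
  have h2 : (B *ᵥ x) ⬝ᵥ (S *ᵥ x) = x ⬝ᵥ (S *ᵥ (B *ᵥ x)) := by
    rw [dotProduct_comm (B *ᵥ x), Matrix.dotProduct_mulVec x S, ← Matrix.mulVec_transpose, hT]
  rw [h2] at h
  simp only [linField]
  linarith

/-- Differentiate the identity `⟨q, C x⟩ = 0` along `B` and use that `B` is skew. The involution
property then follows from orthogonality, without showing that `lieAlg G` is closed under
commutators. -/
theorem lieBracket_linField_orthogonal (hS : IsInvariantScalarProduct G S)
    {p : MvPolynomial (Fin n) ℝ} (hp : p ∈ invariantAlgebra G)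
    {B C : Matrix (Fin n) (Fin n) ℝ} (hB : B ∈ lieAlg G) (hC : C ∈ lieAlg G) (x : Fin n → ℝ) :
    gradField S p x ⬝ᵥ (S *ᵥ VectorField.lieBracket ℝ (linField B) (linField C) x) = 0 := by
  have h1 := hasDerivAt_dotProduct_mulVec S
    (hasDerivAt_comp_exp (analyticAt_gradField S p x).differentiableAt B)
    (hasDerivAt_comp_exp (analyticAt_linField C x).differentiableAt B)
  have h2 : (fun t : ℝ => gradField S p (NormedSpace.exp (t • B) *ᵥ x) ⬝ᵥ
      (S *ᵥ linField C (NormedSpace.exp (t • B) *ᵥ x))) = fun _ => 0 :=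
    funext fun t => gradField_orthogonal hS.1 hp hC _
  rw [h2] at h1
  have h3 := h1.unique (hasDerivAt_const _ _)
  rw [exp_zero_smul_mulVec, fderiv_gradField_linField hS hp hB, fderiv_linField] at h3
  have h4 := lieAlg_skew hS hB (gradField S p x) (C *ᵥ x)
  simp only [VectorField.lieBracket, fderiv_linField, linField] at h3 h4 ⊢
  rw [Matrix.mulVec_sub, dotProduct_sub]
  linarith

end

/-! ### The moving frame of orbit directions and gradients, with analytic coefficients. -/

section

variable {n s : ℕ} {E : Type*} [NormedAddCommGroup E] [NormedSpace ℝ E]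

theorem analyticAt_det {ι : Type*} [Fintype ι] [DecidableEq ι] {M : E → Matrix ι ι ℝ} {p : E}
    (hM : ∀ i j, AnalyticAt ℝ (fun y => M y i j) p) : AnalyticAt ℝ (fun y => (M y).det) p := by
  simp only [Matrix.det_apply']
  exact Finset.analyticAt_fun_sum _ fun w _ => analyticAt_const.mul
    (Finset.analyticAt_fun_prod _ fun i _ => hM _ _)

/-- The fields `B₁ x, …, B_s x, q₁(x), …, q_{n-s}(x)`. -/
def frame (S : Matrix (Fin n) (Fin n) ℝ) (B : Fin s → Matrix (Fin n) (Fin n) ℝ)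
    (σ : Fin (n - s) → MvPolynomial (Fin n) ℝ) (x : Fin n → ℝ) :
    Fin s ⊕ Fin (n - s) → Fin n → ℝ :=
  Sum.elim (fun i => linField (B i) x) (fun j => gradField S (σ j) x)

/-- The matrix whose determinant is `theta`. -/
def thetaMatrix (S : Matrix (Fin n) (Fin n) ℝ) (B : Fin s → Matrix (Fin n) (Fin n) ℝ)
    (σ : Fin (n - s) → MvPolynomial (Fin n) ℝ) (x : Fin n → ℝ) : Matrix (Fin n) (Fin n) ℝ :=
  Matrix.of fun i c : Fin n =>
    if h : c.1 < s then linField (B ⟨c.1, h⟩) x i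
    else gradField S (σ ⟨c.1 - s, by omega⟩) x i

/-- The numbering of the columns of `thetaMatrix`. -/
def frameEquiv (h : s ≤ n) : Fin s ⊕ Fin (n - s) ≃ Fin n :=
  finSumFinEquiv.trans (finCongr (by omega))

theorem thetaMatrix_frameEquiv (h : s ≤ n) (S : Matrix (Fin n) (Fin n) ℝ)
    (B : Fin s → Matrix (Fin n) (Fin n) ℝ) (σ : Fin (n - s) → MvPolynomial (Fin n) ℝ)
    (x : Fin n → ℝ) (k : Fin s ⊕ Fin (n - s)) (i : Fin n) :
    thetaMatrix S B σ x i (frameEquiv h k) = frame S B σ x k i := by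
  rcases k with k | k
  · simp [thetaMatrix, frameEquiv, frame]
  · simp [thetaMatrix, frameEquiv, frame]

theorem analyticAt_thetaMatrix (S : Matrix (Fin n) (Fin n) ℝ)
    (B : Fin s → Matrix (Fin n) (Fin n) ℝ) (σ : Fin (n - s) → MvPolynomial (Fin n) ℝ)
    (x : Fin n → ℝ) (i c : Fin n) : AnalyticAt ℝ (fun x => thetaMatrix S B σ x i c) x := by
  simp only [thetaMatrix, Matrix.of_apply]
  split_ifs with h
  · exact (analyticAt_pi_iff.1 (analyticAt_linField _ x)) i
  · exact (analyticAt_pi_iff.1 (analyticAt_gradField S _ x)) i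

theorem linearIndependent_frame (h : s ≤ n) {S : Matrix (Fin n) (Fin n) ℝ}
    {B : Fin s → Matrix (Fin n) (Fin n) ℝ} {σ : Fin (n - s) → MvPolynomial (Fin n) ℝ}
    {x : Fin n → ℝ} (hθ : theta S B σ x ≠ 0) : LinearIndependent ℝ (frame S B σ x) := by
  have h1 : LinearIndependent ℝ (thetaMatrix S B σ x).col :=
    Matrix.linearIndependent_cols_of_det_ne_zero hθ
  have h2 := h1.comp (frameEquiv h) (frameEquiv h).injective
  have h3 : (thetaMatrix S B σ x).col ∘ frameEquiv h = frame S B σ x := by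
    funext k i; exact thetaMatrix_frameEquiv h S B σ x k i
  rwa [h3] at h2

theorem span_frame (h : s ≤ n) {S : Matrix (Fin n) (Fin n) ℝ}
    {B : Fin s → Matrix (Fin n) (Fin n) ℝ} {σ : Fin (n - s) → MvPolynomial (Fin n) ℝ}
    {x : Fin n → ℝ} (hθ : theta S B σ x ≠ 0) :
    Submodule.span ℝ (Set.range (frame S B σ x)) = ⊤ :=
  (linearIndependent_frame h hθ).span_eq_top_of_card_eq_finrank' (by simp; omega)

/-- By Cramer's rule the coefficients are quotients of analytic determinants with denominator
`theta`. The base point is allowed to move with `ψ` so that the lemma also applies in the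
coordinates of a chart. -/
theorem analyticAt_frame_coeff (h : s ≤ n) {S : Matrix (Fin n) (Fin n) ℝ}
    {B : Fin s → Matrix (Fin n) (Fin n) ℝ} {σ : Fin (n - s) → MvPolynomial (Fin n) ℝ}
    {ψ X : E → Fin n → ℝ} {p : E} (hψ : AnalyticAt ℝ ψ p) (hX : AnalyticAt ℝ X p)
    (hθ : theta S B σ (ψ p) ≠ 0) {c : Fin s ⊕ Fin (n - s) → E → ℝ}
    (hc : ∀ᶠ y in 𝓝 p, X y = ∑ k, c k y • frame S B σ (ψ y) k) (k : Fin s ⊕ Fin (n - s)) :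
    AnalyticAt ℝ (c k) p := by
  have hM : ∀ i j, AnalyticAt ℝ (fun y => thetaMatrix S B σ (ψ y) i j) p := fun i j =>
    (analyticAt_thetaMatrix S B σ (ψ p) i j).comp hψ
  have hdet : AnalyticAt ℝ (fun y => (thetaMatrix S B σ (ψ y)).det) p := analyticAt_det hM
  have hne : (thetaMatrix S B σ (ψ p)).det ≠ 0 := hθ
  have hnum : AnalyticAt ℝ (fun y =>
      ((thetaMatrix S B σ (ψ y)).updateCol (frameEquiv h k) (X y)).det) p := by
    refine analyticAt_det fun i j => ?_
    simp only [Matrix.updateCol_apply]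
    split_ifs
    · exact (analyticAt_pi_iff.1 hX) i
    · exact hM i j
  refine (hnum.div hdet hne).congr ?_
  filter_upwards [hc, hdet.continuousAt.eventually_ne hne] with y hy hyne
  have hmul : X y = thetaMatrix S B σ (ψ y) *ᵥ fun m => c ((frameEquiv h).symm m) y := by
    rw [hy]
    funext i
    simp only [Finset.sum_apply, Pi.smul_apply, smul_eq_mul, Matrix.mulVec, dotProduct]
    rw [← (frameEquiv h).sum_comp]
    exact Finset.sum_congr rfl fun k _ => by
      rw [thetaMatrix_frameEquiv, Equiv.symm_apply_apply, mul_comm]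
  have hcr : Matrix.cramer (thetaMatrix S B σ (ψ y)) (X y) (frameEquiv h k) =
      (thetaMatrix S B σ (ψ y)).det * c k y := by
    rw [hmul, Matrix.cramer_eq_adjugate_mulVec, Matrix.mulVec_mulVec, Matrix.adjugate_mul,
      Matrix.smul_mulVec, Matrix.one_mulVec]
    simp
  simp only [Pi.div_apply]
  rw [div_eq_iff hyne, ← Matrix.cramer_apply, hcr, mul_comm]

variable (G : Subgroup (GL (Fin n) ℝ)) (S : Matrix (Fin n) (Fin n) ℝ)
  (B : Fin s → Matrix (Fin n) (Fin n) ℝ) (σ : Fin (n - s) → MvPolynomial (Fin n) ℝ)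

/-- Elements `B i` of the Lie algebra of `G` and invariant polynomials `σ j`, with an invariant
scalar product. -/
structure IsOrbitFrame : Prop where
  le : s ≤ n
  scalar : IsInvariantScalarProduct G S
  mem_lieAlg : ∀ i, B i ∈ lieAlg G
  invariant : ∀ j, σ j ∈ invariantAlgebra G

/-- The part of a vector field in the directions of the gradients. -/
def gradPart (β : Fin (n - s) → (Fin n → ℝ) → ℝ) (x : Fin n → ℝ) : Fin n → ℝ :=
  ∑ j, β j x • gradField S (σ j) x

variable {G S B σ}

theorem gradField_linearIndependent (h : s ≤ n) {x : Fin n → ℝ} (hθ : theta S B σ x ≠ 0) :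
    LinearIndependent ℝ (fun j => gradField S (σ j) x) :=
  (linearIndependent_frame h hθ).comp Sum.inr Sum.inr_injective

theorem linField_linearIndependent (h : s ≤ n) {x : Fin n → ℝ} (hθ : theta S B σ x ≠ 0) :
    LinearIndependent ℝ (fun i => linField (B i) x) :=
  (linearIndependent_frame h hθ).comp Sum.inl Sum.inl_injective

theorem gradField_coeff_unique (h : s ≤ n) {x : Fin n → ℝ} (hθ : theta S B σ x ≠ 0)
    {c d : Fin (n - s) → ℝ}
    (hcd : ∑ j, c j • gradField S (σ j) x = ∑ j, d j • gradField S (σ j) x) : c = d := by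
  have h1 := Fintype.linearIndependent_iff.1 (gradField_linearIndependent h hθ) (fun j => c j - d j)
    (by simp only [sub_smul, Finset.sum_sub_distrib, hcd, sub_self])
  funext j; exact sub_eq_zero.1 (h1 j)

namespace IsOrbitFrame

variable (H : IsOrbitFrame G S B σ)
include H

theorem exists_coeff {x : Fin n → ℝ} (hθ : theta S B σ x ≠ 0) (v : Fin n → ℝ) :
    ∃ (a : Fin s → ℝ) (b : Fin (n - s) → ℝ),
      v = ∑ i, a i • linField (B i) x + ∑ j, b j • gradField S (σ j) x := by
  have hv : v ∈ Submodule.span ℝ (Set.range (frame S B σ x)) := by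
    rw [span_frame H.le hθ]; trivial
  obtain ⟨c, hc⟩ := (Submodule.mem_span_range_iff_exists_fun ℝ).1 hv
  refine ⟨fun i => c (.inl i), fun j => c (.inr j), ?_⟩
  rw [← hc, Fintype.sum_sum_type]; rfl

/-- A gradient of an invariant polynomial sees only the gradient part of a vector. -/
theorem dotProduct_decomp {p : MvPolynomial (Fin n) ℝ} (hp : p ∈ invariantAlgebra G)
    (x : Fin n → ℝ) (a : Fin s → ℝ) (w : Fin n → ℝ) :
    gradField S p x ⬝ᵥ (S *ᵥ (∑ i, a i • linField (B i) x + w)) =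
      gradField S p x ⬝ᵥ (S *ᵥ w) := by
  rw [Matrix.mulVec_add, dotProduct_add, Matrix.mulVec_sum, dotProduct_sum]
  simp only [Matrix.mulVec_smul, dotProduct_smul,
    gradField_orthogonal H.scalar.1 hp (H.mem_lieAlg _), smul_zero, Finset.sum_const_zero, zero_add]

/-- A vector orthogonal to all gradients is tangent to the orbit. -/
theorem exists_coeff_of_orthogonal {x : Fin n → ℝ} (hθ : theta S B σ x ≠ 0) {v : Fin n → ℝ}
    (hv : ∀ j, gradField S (σ j) x ⬝ᵥ (S *ᵥ v) = 0) :
    ∃ a : Fin s → ℝ, v = ∑ i, a i • linField (B i) x := by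
  obtain ⟨a, b, hab⟩ := H.exists_coeff hθ v
  set w := ∑ j, b j • gradField S (σ j) x with hw
  have hjw : ∀ j, gradField S (σ j) x ⬝ᵥ (S *ᵥ w) = 0 := fun j => by
    rw [← hv j, hab, H.dotProduct_decomp (H.invariant j)]
  -- The gradient part `w` is orthogonal to every gradient and is a combination of them, hence
  -- orthogonal to itself.
  have hww : w ⬝ᵥ (S *ᵥ w) = 0 := by
    conv_lhs => arg 1; rw [hw]
    rw [sum_dotProduct]
    simp [hjw]
  have hw0 : w = 0 := by
    by_contra hne
    have := H.scalar.1.dotProduct_mulVec_pos hne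
    simp only [star_trivial] at this
    exact this.ne' hww
  exact ⟨a, by rw [hab, hw0, add_zero]⟩

theorem exists_analytic_coeff_of_orthogonal {ψ X : E → Fin n → ℝ} {O : Set E} (hO : IsOpen O)
    (hψ : AnalyticOnNhd ℝ ψ O) (hX : AnalyticOnNhd ℝ X O)
    (hθ : ∀ y ∈ O, theta S B σ (ψ y) ≠ 0)
    (hperp : ∀ y ∈ O, ∀ j, gradField S (σ j) (ψ y) ⬝ᵥ (S *ᵥ X y) = 0) :
    ∃ a : Fin s → E → ℝ, (∀ i, AnalyticOnNhd ℝ (a i) O) ∧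
      ∀ y ∈ O, X y = ∑ i, a i y • linField (B i) (ψ y) := by
  choose! a ha using fun y (hy : y ∈ O) => H.exists_coeff_of_orthogonal (hθ y hy) (hperp y hy)
  refine ⟨fun i y => a y i, fun i p hp => ?_, ha⟩
  refine analyticAt_frame_coeff H.le (hψ p hp) (hX p hp) (hθ p hp)
    (c := Sum.elim (fun i y => a y i) (fun _ _ => 0)) ?_ (.inl i)
  filter_upwards [hO.mem_nhds hp] with y hy
  rw [Fintype.sum_sum_type]
  simpa [frame] using ha y hy

/-- By equivariance `B'` commutes with each gradient field, so the bracket differentiates only the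
coefficients. -/
theorem lieBracket_gradPart {B' : Matrix (Fin n) (Fin n) ℝ} (hB' : B' ∈ lieAlg G)
    {β : Fin (n - s) → (Fin n → ℝ) → ℝ} {x : Fin n → ℝ}
    (hβ : ∀ j, DifferentiableAt ℝ (β j) x) :
    VectorField.lieBracket ℝ (linField B') (gradPart S σ β) x =
      ∑ j, fderiv ℝ (β j) x (linField B' x) • gradField S (σ j) x := by
  have h1 : HasFDerivAt (gradPart S σ β) (∑ j, (β j x • fderiv ℝ (gradField S (σ j)) x +
      (fderiv ℝ (β j) x).smulRight (gradField S (σ j) x))) x :=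
    HasFDerivAt.fun_sum fun j _ => (hβ j).hasFDerivAt.smul
      (analyticAt_gradField S (σ j) x).differentiableAt.hasFDerivAt
  rw [VectorField.lieBracket, h1.fderiv, fderiv_linField]
  simp only [_root_.sum_apply, _root_.add_apply,
    _root_.smul_apply, ContinuousLinearMap.smulRight_apply,
    fderiv_gradField_linField H.scalar (H.invariant _) hB', Finset.sum_add_distrib]
  simp only [gradPart, Matrix.mulVec_sum, Matrix.mulVec_smul]
  abel

end IsOrbitFrame

end

/-! ### Analyticity of integrals depending on a parameter, via superposition operators on bounded
continuous functions. -/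

section

section BoundedContinuous

variable {K : Type*} [TopologicalSpace K] {F : Type*} [NormedAddCommGroup F] {r : ℝ≥0∞}

theorem mem_eball_of_bcf {u : K →ᵇ F} (hu : u ∈ Metric.eball (0 : K →ᵇ F) r) (k : K) :
    u k ∈ Metric.eball (0 : F) r := by
  rw [mem_eball_zero_iff] at hu ⊢
  exact lt_of_le_of_lt (by
    rw [enorm_le_iff_norm_le]; exact u.norm_coe_le_norm k) hu

variable [NormedSpace ℝ F] {Φ : F → ℝ} {p : FormalMultilinearSeries ℝ F ℝ} {z : F}

theorem summable_norm_of_bcf (h : HasFPowerSeriesOnBall Φ p z r) {u : K →ᵇ F}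
    (hu : u ∈ Metric.eball (0 : K →ᵇ F) r) : Summable fun m => ‖p m‖ * ‖u‖ ^ m := by
  have h1 : ((‖u‖₊ : ℝ≥0) : ℝ≥0∞) < p.radius := by
    refine lt_of_lt_of_le ?_ h.r_le
    simpa [mem_eball_zero_iff, enorm_eq_nnnorm] using hu
  simpa using p.summable_norm_mul_pow h1

theorem norm_multilinear_bcf_le (u : K →ᵇ F) (m : ℕ) (k : K) :
    ‖p m fun _ => u k‖ ≤ ‖p m‖ * ‖u‖ ^ m := by
  refine ((p m).le_opNorm _).trans ?_
  rw [Finset.prod_const, Finset.card_univ, Fintype.card_fin]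
  gcongr
  exact u.norm_coe_le_norm k

theorem analyticAt_bcf_const (x : F) :
    AnalyticAt ℝ (fun x : F => BoundedContinuousFunction.const K x) x := by
  let L : F →L[ℝ] (K →ᵇ F) := LinearMap.mkContinuous
    { toFun := fun x => BoundedContinuousFunction.const K x
      map_add' := fun _ _ => rfl
      map_smul' := fun _ _ => rfl } 1 fun x => by
        rw [one_mul]; exact BoundedContinuousFunction.norm_const_le x
  exact L.analyticAt x

end BoundedContinuous

section Nemytskii

variable {K : Type*} [TopologicalSpace K] [MeasurableSpace K] [OpensMeasurableSpace K]
  (μ : Measure K) [IsFiniteMeasure μ]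
  {F : Type*} [NormedAddCommGroup F] [NormedSpace ℝ F]

theorem integrable_multilinear_bcf {m : ℕ} (p : F [×m]→L[ℝ] ℝ) (v : Fin m → (K →ᵇ F)) :
    Integrable (fun k => p fun i => v i k) μ := by
  refine Integrable.of_bound (C := ‖p‖ * ∏ i, ‖v i‖) ?_ (Eventually.of_forall fun k => ?_)
  · exact (p.cont.comp (continuous_pi fun i => (v i).continuous)).aestronglyMeasurable
  · refine (p.le_opNorm _).trans ?_
    gcongr with i
    exact (v i).norm_coe_le_norm k

/-- The integral of a multilinear map applied pointwise to bounded continuous functions. -/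
def integralMultilinear {m : ℕ} (p : F [×m]→L[ℝ] ℝ) : (K →ᵇ F) [×m]→L[ℝ] ℝ :=
  MultilinearMap.mkContinuous
    { toFun := fun v => ∫ k, p (fun i => v i k) ∂μ
      map_update_add' := by
        intro inst v i x y
        rw [← integral_add (integrable_multilinear_bcf μ p _) (integrable_multilinear_bcf μ p _)]
        congr 1; funext k
        have h : ∀ z : K →ᵇ F, (fun j => (Function.update v i z) j k) =
            Function.update (fun j => v j k) i (z k) := fun z => by
          funext j; by_cases hj : j = i
          · subst hj; simp
          · simp [hj]
        rw [h, h, h]; exact p.map_update_add _ _ _ _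
      map_update_smul' := by
        intro inst v i c x
        rw [smul_eq_mul, ← integral_const_mul]
        congr 1; funext k
        have h : ∀ z : K →ᵇ F, (fun j => (Function.update v i z) j k) =
            Function.update (fun j => v j k) i (z k) := fun z => by
          funext j; by_cases hj : j = i
          · subst hj; simp
          · simp [hj]
        rw [h, h]; exact p.map_update_smul _ _ _ _ }
    (‖p‖ * μ.real Set.univ) (by
      intro v
      have h := norm_integral_le_of_norm_le_const (μ := μ) (f := fun k => p fun i => v i k)
        (C := ‖p‖ * ∏ i, ‖v i‖) (Eventually.of_forall fun k => by
          refine (p.le_opNorm _).trans ?_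
          gcongr with i
          exact (v i).norm_coe_le_norm k)
      refine h.trans (le_of_eq ?_)
      ring)

theorem norm_integralMultilinear_le {m : ℕ} (p : F [×m]→L[ℝ] ℝ) :
    ‖integralMultilinear (K := K) μ p‖ ≤ ‖p‖ * μ.real Set.univ :=
  MultilinearMap.mkContinuous_norm_le _ (by positivity) _

variable {μ} {Φ : F → ℝ} {p : FormalMultilinearSeries ℝ F ℝ} {z : F} {r : ℝ≥0∞}

theorem integrable_comp_bcf (h : HasFPowerSeriesOnBall Φ p z r) {u : K →ᵇ F}
    (hu : u ∈ Metric.eball (0 : K →ᵇ F) r) : Integrable (fun k => Φ (z + u k)) μ := by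
  refine Integrable.of_bound (C := ∑' m, ‖p m‖ * ‖u‖ ^ m) ?_ (Eventually.of_forall fun k => ?_)
  · refine Continuous.aestronglyMeasurable ?_
    refine h.continuousOn.comp_continuous (continuous_const.add u.continuous) fun k => ?_
    simpa [Metric.mem_eball, edist_eq_enorm_sub] using mem_eball_of_bcf hu k
  · have hs := h.hasSum (mem_eball_of_bcf hu k)
    rw [← hs.tsum_eq]
    exact tsum_of_norm_bounded (summable_norm_of_bcf h hu).hasSum
      fun m => norm_multilinear_bcf_le u m k

/-- The integrated superposition operator defined by an analytic function is analytic on a ball of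
the space of bounded continuous functions. -/
theorem hasFPowerSeriesOnBall_integral_comp (h : HasFPowerSeriesOnBall Φ p z r) :
    HasFPowerSeriesOnBall (fun u : K →ᵇ F => ∫ k, Φ (z + u k) ∂μ)
      (fun m => integralMultilinear μ (p m)) 0 r where
  r_le := by
    refine ENNReal.le_of_forall_nnreal_lt fun ρ hρ => ?_
    obtain ⟨C, hC, hb⟩ := p.norm_mul_pow_le_of_lt_radius (lt_of_lt_of_le hρ h.r_le)
    refine FormalMultilinearSeries.le_radius_of_bound _ (C * μ.real Set.univ) fun m => ?_
    calc ‖integralMultilinear (K := K) μ (p m)‖ * (ρ : ℝ) ^ m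
        ≤ (‖p m‖ * μ.real Set.univ) * (ρ : ℝ) ^ m := by
          gcongr; exact norm_integralMultilinear_le μ (p m)
      _ = (‖p m‖ * (ρ : ℝ) ^ m) * μ.real Set.univ := by ring
      _ ≤ C * μ.real Set.univ := by gcongr; exact hb m
  r_pos := h.r_pos
  hasSum := by
    intro u hu
    have h1 : ∀ k, ∑' m, (p m fun _ => u k) = Φ (z + (0 + u) k) := fun k => by
      rw [zero_add]; exact (h.hasSum (mem_eball_of_bcf hu k)).tsum_eq
    have h2 := hasSum_integral_of_summable_integral_norm (μ := μ)
      (F := fun m k => p m fun _ => u k)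
      (fun m => integrable_multilinear_bcf μ (p m) fun _ => u)
      (((summable_norm_of_bcf h hu).mul_right (μ.real Set.univ)).of_nonneg_of_le
        (fun m => integral_nonneg fun k => norm_nonneg _) fun m => by
          have := norm_integral_le_of_norm_le_const (μ := μ) (f := fun k => ‖p m fun _ => u k‖)
            (C := ‖p m‖ * ‖u‖ ^ m) (Eventually.of_forall fun k => by
              rw [norm_norm]; exact norm_multilinear_bcf_le u m k)
          exact (le_abs_self _).trans this)
    simp only [h1] at h2
    exact h2

end Nemytskii

section Parametric

variable {F : Type*} [NormedAddCommGroup F] [NormedSpace ℝ F]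

/-- The radial retraction onto the closed ball of radius `δ`. -/
def radialRetraction (δ : ℝ) (v : F) : F := (δ / max δ ‖v‖) • v

theorem continuous_radialRetraction {δ : ℝ} (hδ : 0 < δ) :
    Continuous (radialRetraction δ : F → F) := by
  refine Continuous.smul (Continuous.div continuous_const (by fun_prop) fun v => ?_) continuous_id
  exact (lt_max_of_lt_left hδ).ne'

theorem norm_radialRetraction_le {δ : ℝ} (hδ : 0 < δ) (v : F) : ‖radialRetraction δ v‖ ≤ δ := by
  have hm : 0 < max δ ‖v‖ := lt_max_of_lt_left hδ
  rw [radialRetraction, norm_smul, Real.norm_of_nonneg (by positivity), div_mul_eq_mul_div,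
    div_le_iff₀ hm]
  gcongr
  exact le_max_right _ _

theorem radialRetraction_of_norm_le {δ : ℝ} (hδ : 0 < δ) {v : F} (hv : ‖v‖ ≤ δ) :
    radialRetraction δ v = v := by
  rw [radialRetraction, max_eq_left hv, div_self hδ.ne', one_smul]

variable {K : Type*} [TopologicalSpace K] [MeasurableSpace K] [OpensMeasurableSpace K]
  {μ : Measure K} [IsLocallyFiniteMeasure μ]
  {E : Type*} [NormedAddCommGroup E] [NormedSpace ℝ E]

/-- With `k` regarded as the argument of a bounded continuous function, the integrand is `Φ`
evaluated at a curve `U x` in a function space. The map `U` is affine in `x`, and the integrated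
superposition operator is analytic. Only continuity of `e` is used, so `K` needs no differentiable
structure; the lemma is applied to an interval and to the group itself. -/
theorem exists_nhds_analyticAt_setIntegral {e : K → F} (he : Continuous e) {f : K → E → ℝ}
    {x₀ : E} {k₀ : K} {Φ : F × E → ℝ} (hΦ : AnalyticAt ℝ Φ (e k₀, x₀))
    (hf : ∀ᶠ q : K × E in 𝓝 (k₀, x₀), f q.1 q.2 = Φ (e q.1, q.2)) :
    ∃ T : Set K, IsOpen T ∧ k₀ ∈ T ∧ ∀ t ⊆ T, MeasurableSet t →
      AnalyticAt ℝ (fun x => ∫ k in t, f k x ∂μ) x₀ ∧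
      ∀ᶠ x in 𝓝 x₀, IntegrableOn (fun k => f k x) t μ := by
  obtain ⟨p, r, hp⟩ := hΦ
  obtain ⟨δ', hδ', hδr⟩ := ENNReal.lt_iff_exists_nnreal_btwn.1 hp.r_pos
  have hδ : (0 : ℝ) < δ' := by exact_mod_cast hδ'
  obtain ⟨T₀, hT₀, X, hX, hTX⟩ := mem_nhds_prod_iff.1 hf
  obtain ⟨T₁, hT₁, hμT₁⟩ := μ.finiteAt_nhds k₀
  have hball : {k | ‖e k - e k₀‖ < δ'} ∈ 𝓝 k₀ := by
    have : ContinuousAt (fun k => ‖e k - e k₀‖) k₀ := by fun_prop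
    exact this.eventually_lt continuousAt_const (by simpa using hδ)
  obtain ⟨T, hTsub, hTo, hkT⟩ := mem_nhds_iff.1 (inter_mem (inter_mem hT₀ hT₁) hball)
  refine ⟨T, hTo, hkT, fun t ht htm => ?_⟩
  have : IsFiniteMeasure (μ.restrict t) := by
    constructor
    rw [Measure.restrict_apply_univ]
    exact lt_of_le_of_lt (measure_mono fun k hk => (hTsub (ht hk)).1.2) hμT₁
  -- The retraction makes `e k - e k₀` bounded on all of `K`, by a radius below the radius of
  -- convergence, and changes nothing for `k` in `T`.
  let u₀ : K →ᵇ F := BoundedContinuousFunction.ofNormedAddCommGroup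
    (fun k => radialRetraction δ' (e k - e k₀))
    ((continuous_radialRetraction hδ).comp (he.sub continuous_const)) δ'
    fun k => norm_radialRetraction_le hδ _
  let U : E → (K →ᵇ F × E) := fun x => BoundedContinuousFunction.ofNormedAddCommGroup
    (fun k => (u₀ k, x - x₀)) (u₀.continuous.prodMk continuous_const) (max δ' ‖x - x₀‖)
    fun k => by
      rw [Prod.norm_def]
      exact max_le_max (norm_radialRetraction_le hδ _) le_rfl
  have hUan : AnalyticAt ℝ U x₀ := by
    have h1 : U = fun x => U x₀ + BoundedContinuousFunction.const K ((0 : F), x - x₀) := by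
      funext x; ext k
      · simp [U]
      · simp [U]
    rw [h1]
    refine analyticAt_const.add ?_
    exact (analyticAt_bcf_const (K := K) ((0 : F), x₀ - x₀)).comp
      (f := fun x : E => ((0 : F), x - x₀))
      (analyticAt_const.prod (analyticAt_id.sub analyticAt_const))
  have hUmem : U x₀ ∈ Metric.eball (0 : K →ᵇ F × E) r := by
    rw [mem_eball_zero_iff]
    refine lt_of_le_of_lt ?_ hδr
    rw [enorm_eq_nnnorm, ENNReal.coe_le_coe, ← NNReal.coe_le_coe, coe_nnnorm]
    refine (BoundedContinuousFunction.norm_le hδ.le).2 fun k => ?_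
    simp only [U, BoundedContinuousFunction.coe_ofNormedAddCommGroup, sub_self, Prod.norm_def,
      norm_zero]
    exact max_le (norm_radialRetraction_le hδ _) hδ.le
  have hval : ∀ x ∈ X, ∀ k ∈ t, f k x = Φ ((e k₀, x₀) + U x k) := by
    intro x hx k hk
    have hk' := hTsub (ht hk)
    rw [show f k x = Φ (e k, x) from hTX (Set.mk_mem_prod hk'.1.1 hx)]
    congr 1
    have : u₀ k = e k - e k₀ := radialRetraction_of_norm_le hδ (le_of_lt hk'.2)
    simp [U, this]
  constructor
  · have h1 := ((hasFPowerSeriesOnBall_integral_comp (μ := μ.restrict t)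
      hp).analyticAt_of_mem hUmem).comp hUan
    refine h1.congr ?_
    filter_upwards [hX] with x hx
    exact (setIntegral_congr_fun htm fun k hk => hval x hx k hk).symm
  · filter_upwards [hX, hUan.continuousAt.eventually_mem (Metric.isOpen_eball.mem_nhds hUmem)]
      with x hx hxU
    have h2 := integrable_comp_bcf (μ := μ.restrict t) hp hxU
    exact IntegrableOn.congr_fun h2 (fun k hk => (hval x hx k hk).symm) htm

/-- A parametric integral over a compact set is analytic if the integrand is locally an analytic
function of the parameter and of a continuous function of the variable of integration. -/
theorem analyticAt_setIntegral {e : K → F} (he : Continuous e) {f : K → E → ℝ} {x₀ : E}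
    {C : Set K} (hC : IsCompact C) (hCm : MeasurableSet C)
    (hf : ∀ k₀ ∈ C, ∃ Φ : F × E → ℝ, AnalyticAt ℝ Φ (e k₀, x₀) ∧
      ∀ᶠ q : K × E in 𝓝 (k₀, x₀), f q.1 q.2 = Φ (e q.1, q.2)) :
    AnalyticAt ℝ (fun x => ∫ k in C, f k x ∂μ) x₀ ∧
      IntegrableOn (fun k => f k x₀) C μ := by
  -- Asking for all measurable subsets of `T` makes the property stable under unions, since a subset
  -- of a union can be cut into two disjoint pieces.
  let P : Set K → Prop := fun s => ∃ T : Set K, MeasurableSet T ∧ s ⊆ T ∧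
    ∀ t ⊆ T, MeasurableSet t → AnalyticAt ℝ (fun x => ∫ k in t, f k x ∂μ) x₀ ∧
      ∀ᶠ x in 𝓝 x₀, IntegrableOn (fun k => f k x) t μ
  have hP : P C := by
    refine hC.induction_on (p := P) ?_ ?_ ?_ ?_
    · refine ⟨∅, MeasurableSet.empty, subset_rfl, fun t ht _ => ?_⟩
      obtain rfl := Set.subset_empty_iff.1 ht
      simpa using analyticAt_const
    · rintro s t hst ⟨T, hT, hsub, h⟩
      exact ⟨T, hT, hst.trans hsub, h⟩
    · rintro s t ⟨T, hT, hsT, h⟩ ⟨T', hT', htT', h'⟩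
      refine ⟨T ∪ T', hT.union hT', Set.union_subset_union hsT htT', fun w hw hwm => ?_⟩
      obtain ⟨a1, i1⟩ := h (w ∩ T) Set.inter_subset_right (hwm.inter hT)
      obtain ⟨a2, i2⟩ := h' (w \ T) (fun k hk => (hw hk.1).resolve_left hk.2) (hwm.diff hT)
      have hi : ∀ᶠ x in 𝓝 x₀, IntegrableOn (fun k => f k x) w μ := by
        filter_upwards [i1, i2] with x h1 h2
        have := h1.union h2
        rwa [Set.inter_union_sdiff] at this
      refine ⟨(a1.add a2).congr ?_, hi⟩
      filter_upwards [hi] with x hx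
      exact integral_inter_add_sdiff hT hx
    · intro k hk
      obtain ⟨Φ, hΦ, hfΦ⟩ := hf k hk
      obtain ⟨T, hTo, hkT, h⟩ := exists_nhds_analyticAt_setIntegral (μ := μ) he hΦ hfΦ
      exact ⟨T, mem_nhdsWithin_of_mem_nhds (hTo.mem_nhds hkT), T, hTo.measurableSet,
        subset_rfl, h⟩
  obtain ⟨T, hT, hCT, h⟩ := hP
  obtain ⟨h1, h2⟩ := h C hCT hCm
  exact ⟨h1, h2.self_of_nhds⟩

end Parametric

end

/-! ### Charts adapted to the fibres of `σ`, and linear transport along these fibres. -/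

section

/-- A scalar linear differential equation `u' = k u` on `[0, 1]`. -/
theorem eq_exp_integral_mul_of_hasDerivAt {u k : ℝ → ℝ}
    (hk : ContinuousOn k (Set.Icc 0 1))
    (hu : ∀ t ∈ Set.Icc (0 : ℝ) 1, HasDerivAt u (k t * u t) t) :
    u 1 = Real.exp (∫ t in Set.Icc (0 : ℝ) 1, k t) * u 0 := by
  -- The coefficient is extended by its end values, so that its primitive is differentiable at the
  -- end points too.
  let k' : ℝ → ℝ := Set.IccExtend zero_le_one ((Set.Icc (0 : ℝ) 1).domRestrict k)
  have hk'c : Continuous k' := (continuousOn_iff_continuous_domRestrict.1 hk).Icc_extend'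
  have hk' : ∀ t ∈ Set.Icc (0 : ℝ) 1, k' t = k t := fun t ht => by
    simp only [k']; rw [Set.IccExtend_of_mem _ _ ht]; rfl
  have hint : ∫ t in Set.Icc (0 : ℝ) 1, k t = ∫ t in (0 : ℝ)..1, k' t := by
    rw [intervalIntegral.integral_of_le zero_le_one, ← integral_Icc_eq_integral_Ioc]
    exact setIntegral_congr_fun measurableSet_Icc fun t ht => (hk' t ht).symm
  have hder : ∀ t ∈ Set.Icc (0 : ℝ) 1,
      HasDerivAt (fun t => Real.exp (-∫ x in (0 : ℝ)..t, k' x) * u t) 0 t := by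
    intro t ht
    have h1 : HasDerivAt (fun t => ∫ x in (0 : ℝ)..t, k' x) (k' t) t :=
      hk'c.integral_hasStrictDerivAt 0 t |>.hasDerivAt
    have h2 := (h1.fun_neg.exp).fun_mul (hu t ht)
    refine h2.congr_deriv ?_
    rw [hk' t ht]; ring
  have hconst := constant_of_has_deriv_right_zero
    (f := fun t => Real.exp (-∫ x in (0 : ℝ)..t, k' x) * u t) (a := 0) (b := 1)
    (fun t ht => (hder t ht).continuousAt.continuousWithinAt)
    (fun t ht => (hder t ⟨ht.1, ht.2.le⟩).hasDerivWithinAt) 1 (by simp)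
  simp only [intervalIntegral.integral_same, neg_zero, Real.exp_zero, one_mul] at hconst
  rw [hint, ← hconst, ← mul_assoc, ← Real.exp_add, add_neg_cancel, Real.exp_zero, one_mul]

variable {n s : ℕ}

theorem analyticAt_polyMap {r : ℕ} (τ : Fin r → MvPolynomial (Fin n) ℝ) (x : Fin n → ℝ) :
    AnalyticAt ℝ (polyMap τ) x :=
  AnalyticAt.pi fun l => analyticAt_polyFun (τ l) x

theorem fderiv_polyMap_apply {r : ℕ} (τ : Fin r → MvPolynomial (Fin n) ℝ) (x v : Fin n → ℝ)
    (l : Fin r) : fderiv ℝ (polyMap τ) x v l = fderiv ℝ (polyFun (τ l)) x v := by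
  have h : HasFDerivAt (polyMap τ)
      (ContinuousLinearMap.pi fun l => fderiv ℝ (polyFun (τ l)) x) x :=
    hasFDerivAt_pi.2 fun l => (analyticAt_polyFun (τ l) x).differentiableAt.hasFDerivAt
  rw [h.fderiv]; rfl

/-- An analytic parametrization of a neighbourhood `N` of `x₀`, adapted to the fibres of the
polynomial map given by `σ`. -/
structure FibreChart (σ : Fin (n - s) → MvPolynomial (Fin n) ℝ) (x₀ : Fin n → ℝ) where
  /-- coordinates along the fibres -/
  ℓ : (Fin n → ℝ) →L[ℝ] (Fin s → ℝ)
  /-- the size of the parameter domain -/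
  δ : ℝ
  /-- the parametrization -/
  ψ : (Fin (n - s) → ℝ) × (Fin s → ℝ) → Fin n → ℝ
  /-- the parametrized neighbourhood -/
  N : Set (Fin n → ℝ)
  δ_pos : 0 < δ
  isOpen_N : IsOpen N
  mem_N : x₀ ∈ N
  analytic : AnalyticOnNhd ℝ ψ (Metric.ball (polyMap σ x₀, ℓ x₀) δ)
  mapsTo : Set.MapsTo ψ (Metric.ball (polyMap σ x₀, ℓ x₀) δ) N
  polyMap_ψ : ∀ p ∈ Metric.ball (polyMap σ x₀, ℓ x₀) δ, polyMap σ (ψ p) = p.1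
  mem_ball : ∀ x ∈ N, (polyMap σ x, ℓ x) ∈ Metric.ball (polyMap σ x₀, ℓ x₀) δ
  ψ_eq : ∀ x ∈ N, ψ (polyMap σ x, ℓ x) = x

namespace IsOrbitFrame

variable {G : Subgroup (GL (Fin n) ℝ)} {S : Matrix (Fin n) (Fin n) ℝ}
  {B : Fin s → Matrix (Fin n) (Fin n) ℝ} {σ : Fin (n - s) → MvPolynomial (Fin n) ℝ}
  (H : IsOrbitFrame G S B σ)
include H

/-- The inverse function theorem applies to `x ↦ (σ x, ℓ x)`, where `ℓ` pairs `x` with the tangent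
vectors `B i x₀`. A vector in the kernel of the derivative is orthogonal to all gradients, hence
tangent to the orbit, and orthogonal to all tangent vectors, hence zero. -/
theorem exists_fibreChart {V : Set (Fin n → ℝ)} (hV : IsOpen V) {x₀ : Fin n → ℝ} (hx₀ : x₀ ∈ V)
    (hθ : theta S B σ x₀ ≠ 0) : ∃ c : FibreChart σ x₀, c.N ⊆ V := by
  let ℓ : (Fin n → ℝ) →L[ℝ] (Fin s → ℝ) := LinearMap.toContinuousLinearMap
    (LinearMap.pi fun i =>
      { toFun := fun x => linField (B i) x₀ ⬝ᵥ (S *ᵥ x)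
        map_add' := fun x y => by rw [Matrix.mulVec_add, dotProduct_add]
        map_smul' := fun c x => by rw [Matrix.mulVec_smul, dotProduct_smul]; rfl })
  have hℓ : ∀ x i, ℓ x i = linField (B i) x₀ ⬝ᵥ (S *ᵥ x) := fun x i => rfl
  let φ : (Fin n → ℝ) → (Fin (n - s) → ℝ) × (Fin s → ℝ) := fun x => (polyMap σ x, ℓ x)
  have hφ : ∀ x, AnalyticAt ℝ φ x := fun x => (analyticAt_polyMap σ x).prod (ℓ.analyticAt x)
  have hφ' : fderiv ℝ φ x₀ = (fderiv ℝ (polyMap σ) x₀).prod ℓ :=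
    ((analyticAt_polyMap σ x₀).differentiableAt.hasFDerivAt.prodMk ℓ.hasFDerivAt).fderiv
  have hinj : Function.Injective (fderiv ℝ φ x₀).toLinearMap := by
    rw [← LinearMap.ker_eq_bot, LinearMap.ker_eq_bot']
    intro v hv
    have hv' : fderiv ℝ φ x₀ v = 0 := hv
    rw [hφ'] at hv'
    obtain ⟨h1, h2⟩ := Prod.mk_eq_zero.1 hv'
    obtain ⟨a, ha⟩ := H.exists_coeff_of_orthogonal hθ (v := v) fun j => by
      rw [← gradField_spec H.scalar.1, ← fderiv_polyMap_apply]; exact congrFun h1 j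
    have hvv : v ⬝ᵥ (S *ᵥ v) = 0 := by
      conv_lhs => arg 1; rw [ha]
      rw [sum_dotProduct]
      refine Finset.sum_eq_zero fun i _ => ?_
      have h3 : ℓ v i = 0 := congrFun h2 i
      rw [smul_dotProduct, ← hℓ, h3, smul_zero]
    by_contra hne
    have := H.scalar.1.dotProduct_mulVec_pos hne
    simp only [star_trivial] at this
    exact this.ne' hvv
  have hle := H.le
  let i : (Fin n → ℝ) ≃L[ℝ] (Fin (n - s) → ℝ) × (Fin s → ℝ) :=
    (LinearMap.linearEquivOfInjective (fderiv ℝ φ x₀).toLinearMap hinj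
      (by simp; omega)).toContinuousLinearEquiv
  have hi : fderiv ℝ φ x₀ = i := by ext1 v; rfl
  have hst : HasStrictFDerivAt φ (i : (Fin n → ℝ) →L[ℝ] _) x₀ := by
    rw [← hi]; exact (hφ x₀).hasStrictFDerivAt
  let e := hst.toOpenPartialHomeomorph φ
  have heφ : ∀ x, e x = φ x := fun x => rfl
  have hx₀e : x₀ ∈ e.source := hst.mem_toOpenPartialHomeomorph_source
  have hsymm : AnalyticAt ℝ e.symm (φ x₀) := e.analyticAt_symm' hx₀e (hφ x₀) hi
  have hsx₀ : e.symm (φ x₀) = x₀ := e.left_inv hx₀e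
  have hnhds : e.target ∩ {p | AnalyticAt ℝ e.symm p} ∩ e.symm ⁻¹' V ∈ 𝓝 (φ x₀) := by
    refine inter_mem (inter_mem (e.open_target.mem_nhds (e.map_source hx₀e))
      ((isOpen_analyticAt ℝ _).mem_nhds hsymm)) ?_
    exact hsymm.continuousAt.preimage_mem_nhds (by rw [hsx₀]; exact hV.mem_nhds hx₀)
  obtain ⟨δ, hδ, hsub⟩ := Metric.mem_nhds_iff.1 hnhds
  refine ⟨{ ℓ := ℓ, δ := δ, ψ := e.symm, N := e.source ∩ φ ⁻¹' Metric.ball (φ x₀) δ, δ_pos := hδ,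
            isOpen_N := ?_, mem_N := ?_, analytic := ?_, mapsTo := ?_, polyMap_ψ := ?_,
            mem_ball := ?_, ψ_eq := ?_ }, ?_⟩
  · refine e.open_source.inter (Metric.isOpen_ball.preimage ?_)
    exact continuous_iff_continuousAt.2 fun x => (hφ x).continuousAt
  · exact ⟨hx₀e, Metric.mem_ball_self hδ⟩
  · exact fun p hp => (hsub hp).1.2
  · intro p hp
    refine ⟨e.map_target (hsub hp).1.1, ?_⟩
    rw [Set.mem_preimage, show φ (e.symm p) = p from e.right_inv (hsub hp).1.1]; exact hp
  · intro p hp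
    exact congrArg Prod.fst (e.right_inv (hsub hp).1.1)
  · exact fun x hx => hx.2
  · exact fun x hx => e.left_inv hx.1
  · intro x hx
    have := (hsub hx.2).2
    rwa [Set.mem_preimage, ← heφ, e.left_inv hx.1] at this

/-- Functions which satisfy the same first order linear equations along the orbits are multiplied by
the same factor along the fibres of a chart. -/
theorem exists_transport {x₀ : Fin n → ℝ} (c : FibreChart σ x₀)
    (hθ : ∀ x ∈ c.N, theta S B σ x ≠ 0) {a : Fin s → (Fin n → ℝ) → ℝ}
    (ha : ∀ i, AnalyticOnNhd ℝ (a i) c.N) :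
    ∃ A : (Fin (n - s) → ℝ) × (Fin s → ℝ) → ℝ,
      AnalyticOnNhd ℝ A (Metric.ball (polyMap σ x₀, c.ℓ x₀) c.δ) ∧
      ∀ φ : (Fin n → ℝ) → ℝ, (∀ x ∈ c.N, DifferentiableAt ℝ φ x) →
        (∀ x ∈ c.N, ∀ i, fderiv ℝ φ x (linField (B i) x) = a i x * φ x) →
        ∀ p ∈ Metric.ball (polyMap σ x₀, c.ℓ x₀) c.δ,
          φ (c.ψ p) = Real.exp (A p) * φ (c.ψ (p.1, c.ℓ x₀)) := by
  set O := Metric.ball (polyMap σ x₀, c.ℓ x₀) c.δ with hO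
  have hOo : IsOpen O := Metric.isOpen_ball
  -- Moving in the second group of coordinates keeps `σ` fixed, so these derivatives of `ψ` are
  -- tangent to the orbits.
  have hω : ∀ k : Fin s, ∃ w : Fin s → (Fin (n - s) → ℝ) × (Fin s → ℝ) → ℝ,
      (∀ i, AnalyticOnNhd ℝ (w i) O) ∧ ∀ p ∈ O,
        fderiv ℝ c.ψ p (0, Pi.single k 1) = ∑ i, w i p • linField (B i) (c.ψ p) := by
    intro k
    refine H.exists_analytic_coeff_of_orthogonal hOo c.analytic
      (X := fun p => fderiv ℝ c.ψ p (0, Pi.single k 1)) ?_ (fun p hp => hθ _ (c.mapsTo hp)) ?_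
    · exact fun p hp => ((ContinuousLinearMap.apply ℝ (Fin n → ℝ) ((0, Pi.single k 1) :
        (Fin (n - s) → ℝ) × (Fin s → ℝ))).analyticAt _).comp (c.analytic.fderiv p hp)
    · intro p hp j
      rw [← gradField_spec H.scalar.1, ← fderiv_polyMap_apply]
      have h1 : HasFDerivAt (fun p => polyMap σ (c.ψ p))
          ((fderiv ℝ (polyMap σ) (c.ψ p)).comp (fderiv ℝ c.ψ p)) p :=
        (analyticAt_polyMap σ _).differentiableAt.hasFDerivAt.comp p
          (c.analytic p hp).differentiableAt.hasFDerivAt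
      have h2 : HasFDerivAt (fun p => polyMap σ (c.ψ p))
          (ContinuousLinearMap.fst ℝ (Fin (n - s) → ℝ) (Fin s → ℝ)) p := by
        refine hasFDerivAt_fst.congr_of_eventuallyEq ?_
        filter_upwards [hOo.mem_nhds hp] with q hq using c.polyMap_ψ q hq
      have h3 := congrArg (fun L => L (0, Pi.single k 1)) (h1.unique h2)
      exact congrFun h3 j
  choose w hw hψw using hω
  -- The logarithmic rate of change in the fibre direction `b`; it depends on the functions `a`, not
  -- on `φ`.
  let κ : (Fin (n - s) → ℝ) × (Fin s → ℝ) → (Fin s → ℝ) → ℝ :=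
    fun p b => ∑ k, b k * ∑ i, w k i p * a i (c.ψ p)
  -- The segment in the fibre coordinates from the base value `c.ℓ x₀` to `p.2`; it stays in the
  -- ball because balls are convex. The exponent `A` is the integral of `κ` along it.
  let R : ℝ → (Fin (n - s) → ℝ) × (Fin s → ℝ) → (Fin (n - s) → ℝ) × (Fin s → ℝ) :=
    fun t p => (p.1, c.ℓ x₀ + t • (p.2 - c.ℓ x₀))
  have hR : ∀ t ∈ Set.Icc (0 : ℝ) 1, ∀ p ∈ O, R t p ∈ O := by
    intro t ht p hp
    rw [hO, Metric.mem_ball, Prod.dist_eq, max_lt_iff] at hp ⊢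
    refine ⟨hp.1, lt_of_le_of_lt ?_ hp.2⟩
    simp only [R, dist_eq_norm, add_sub_cancel_left, norm_smul, Real.norm_of_nonneg ht.1]
    exact mul_le_of_le_one_left (norm_nonneg _) ht.2
  have hκan : ∀ t ∈ Set.Icc (0 : ℝ) 1, ∀ p ∈ O,
      AnalyticAt ℝ (fun q : ℝ × ((Fin (n - s) → ℝ) × (Fin s → ℝ)) =>
        κ (R q.1 q.2) (q.2.2 - c.ℓ x₀)) (t, p) := by
    intro t ht p hp
    have h0 : AnalyticAt ℝ (fun q : ℝ × ((Fin (n - s) → ℝ) × (Fin s → ℝ)) => q.2.2) (t, p) :=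
      analyticAt_snd.comp analyticAt_snd
    have h1 : AnalyticAt ℝ (fun q : ℝ × ((Fin (n - s) → ℝ) × (Fin s → ℝ)) => R q.1 q.2) (t, p) :=
      (analyticAt_fst.comp analyticAt_snd).prod
        (analyticAt_const.add (analyticAt_fst.smul (h0.sub analyticAt_const)))
    refine Finset.analyticAt_fun_sum _ fun k _ => AnalyticAt.mul ?_
      (Finset.analyticAt_fun_sum _ fun i _ => AnalyticAt.mul ?_ ?_)
    · exact (analyticAt_pi_iff.1 (h0.sub analyticAt_const)) k
    · exact (hw k i _ (hR t ht p hp)).comp_of_eq h1 rfl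
    · exact (ha i _ (c.mapsTo (hR t ht p hp))).comp_of_eq
        ((c.analytic _ (hR t ht p hp)).comp_of_eq h1 rfl) rfl
  refine ⟨fun p => ∫ t in Set.Icc (0 : ℝ) 1, κ (R t p) (p.2 - c.ℓ x₀), fun p hp => ?_, ?_⟩
  · exact (analyticAt_setIntegral (μ := volume) (e := fun t : ℝ => t) continuous_id
      (f := fun t p => κ (R t p) (p.2 - c.ℓ x₀)) isCompact_Icc measurableSet_Icc
      fun t ht => ⟨_, hκan t ht p hp, Eventually.of_forall fun q => rfl⟩).1
  · intro φ hφd hφ p hp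
    have h := eq_exp_integral_mul_of_hasDerivAt (u := fun t => φ (c.ψ (R t p)))
      (k := fun t => κ (R t p) (p.2 - c.ℓ x₀)) ?_ ?_
    · simpa [R] using h
    · intro t ht
      have : ContinuousAt (fun t : ℝ => (t, p)) t := by fun_prop
      exact (ContinuousAt.comp (f := fun t : ℝ => (t, p)) (hκan t ht p hp).continuousAt
        this).continuousWithinAt
    · intro t ht
      have hRd : HasDerivAt (fun t => R t p) (0, p.2 - c.ℓ x₀) t := by
        refine (hasDerivAt_const t p.1).prodMk ?_
        simpa using ((hasDerivAt_id t).smul_const (p.2 - c.ℓ x₀)).const_add (c.ℓ x₀)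
      have hmem := hR t ht p hp
      have h1 := (hφd _ (c.mapsTo hmem)).hasFDerivAt.comp_hasDerivAt t
        ((c.analytic _ hmem).differentiableAt.hasFDerivAt.comp_hasDerivAt t hRd)
      refine h1.congr_deriv ?_
      have h2 : ((0, p.2 - c.ℓ x₀) : (Fin (n - s) → ℝ) × (Fin s → ℝ)) =
          ∑ k, (p.2 - c.ℓ x₀) k • ((0, Pi.single k 1) : (Fin (n - s) → ℝ) × (Fin s → ℝ)) := by
        have : p.2 - c.ℓ x₀ = ∑ k, (p.2 - c.ℓ x₀) k • (Pi.single k 1 : Fin s → ℝ) := by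
          rw [← pi_eq_sum_univ' (p.2 - c.ℓ x₀)]
        refine Prod.ext ?_ ?_
        · simp [Prod.fst_sum]
        · simpa [Prod.snd_sum] using this
      rw [h2]
      simp only [map_sum, map_smul, hψw _ _ hmem, hφ _ (c.mapsTo hmem), smul_eq_mul, κ,
        Finset.sum_mul, Finset.mul_sum]
      exact Finset.sum_congr rfl fun k _ => Finset.sum_congr rfl fun i _ => by ring

/-- Functions which are constant along the orbits are constant along the fibres of a chart. -/
theorem eq_of_fderiv_eq_zero {x₀ : Fin n → ℝ} (c : FibreChart σ x₀)
    (hθ : ∀ x ∈ c.N, theta S B σ x ≠ 0) {φ : (Fin n → ℝ) → ℝ}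
    (hd : ∀ x ∈ c.N, DifferentiableAt ℝ φ x)
    (hφ : ∀ x ∈ c.N, ∀ i, fderiv ℝ φ x (linField (B i) x) = 0) {x y : Fin n → ℝ}
    (hx : x ∈ c.N) (hy : y ∈ c.N) (hxy : polyMap σ x = polyMap σ y) : φ x = φ y := by
  obtain ⟨A, -, hA⟩ := H.exists_transport c hθ (a := fun _ _ => 0) fun _ => analyticOnNhd_const
  have h1 : ∀ z ∈ c.N, φ z = φ (c.ψ (polyMap σ z, c.ℓ x₀)) := by
    intro z hz
    -- The constant function `1` satisfies the same equations, which identifies the transport factor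
    -- as `1`.
    have e1 := hA (fun _ => 1) (fun _ _ => differentiableAt_const _) (by simp) _ (c.mem_ball z hz)
    have e2 := hA φ hd (by simpa using hφ) _ (c.mem_ball z hz)
    rw [c.ψ_eq z hz] at e2
    rw [mul_one] at e1
    rw [e2, ← e1, one_mul]
  rw [h1 x hx, h1 y hy, hxy]

end IsOrbitFrame

end

/-! ### Haar averaging, separation of orbits by polynomial invariants, and properness of the
invariants. -/

section

section Average

variable {n : ℕ} (G : Subgroup (GL (Fin n) ℝ))

theorem continuous_entry (i j : Fin n) :
    Continuous fun g : G => ((g : GL (Fin n) ℝ) : Matrix (Fin n) (Fin n) ℝ) i j := by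
  have h : Continuous fun g : G => ((g : GL (Fin n) ℝ) : Matrix (Fin n) (Fin n) ℝ) :=
    Units.continuous_val.comp continuous_subtype_val
  exact h.matrix_elem i j

theorem continuous_action :
    Continuous fun q : G × (Fin n → ℝ) =>
      ((q.1 : GL (Fin n) ℝ) : Matrix (Fin n) (Fin n) ℝ) *ᵥ q.2 := by
  have h : Continuous fun q : G × (Fin n → ℝ) =>
      ((q.1 : GL (Fin n) ℝ) : Matrix (Fin n) (Fin n) ℝ) :=
    Units.continuous_val.comp (continuous_subtype_val.comp continuous_fst)
  exact h.matrix_mulVec continuous_snd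

theorem mul_action_eq (g h : G) (x : Fin n → ℝ) :
    (((g * h : G) : GL (Fin n) ℝ) : Matrix (Fin n) (Fin n) ℝ) *ᵥ x =
      ((g : GL (Fin n) ℝ) : Matrix (Fin n) (Fin n) ℝ) *ᵥ
        (((h : GL (Fin n) ℝ) : Matrix (Fin n) (Fin n) ℝ) *ᵥ x) := by
  rw [Matrix.mulVec_mulVec]; simp

theorem one_action_eq (x : Fin n → ℝ) :
    (((1 : G) : GL (Fin n) ℝ) : Matrix (Fin n) (Fin n) ℝ) *ᵥ x = x := by
  simp

theorem inv_action_action (g : G) (x : Fin n → ℝ) :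
    (((g⁻¹ : G) : GL (Fin n) ℝ) : Matrix (Fin n) (Fin n) ℝ) *ᵥ
      (((g : GL (Fin n) ℝ) : Matrix (Fin n) (Fin n) ℝ) *ᵥ x) = x := by
  rw [← mul_action_eq, inv_mul_cancel, one_action_eq]

/-- The polynomial `p (g⁻¹ x)` as a polynomial in `x` with coefficients in `C(G, ℝ)`. -/
def translatePoly (p : MvPolynomial (Fin n) ℝ) : MvPolynomial (Fin n) C(G, ℝ) :=
  MvPolynomial.aeval (fun i => ∑ j, MvPolynomial.C
    (⟨fun g : G => (((g⁻¹ : G) : GL (Fin n) ℝ) : Matrix (Fin n) (Fin n) ℝ) i j,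
      (continuous_entry G i j).comp continuous_inv⟩ : C(G, ℝ)) * MvPolynomial.X j) p

theorem eval_translatePoly (p : MvPolynomial (Fin n) ℝ) (g : G) (x : Fin n → ℝ) :
    MvPolynomial.eval₂ (ContinuousMap.evalAlgHom ℝ ℝ g : C(G, ℝ) →+* ℝ) x (translatePoly G p) =
      polyFun p ((((g⁻¹ : G) : GL (Fin n) ℝ) : Matrix (Fin n) (Fin n) ℝ) *ᵥ x) := by
  induction p using MvPolynomial.induction_on with
  | C a =>
    simp only [translatePoly, polyFun, MvPolynomial.aeval_C, MvPolynomial.eval_C,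
      MvPolynomial.algebraMap_apply, MvPolynomial.eval₂_C]
    exact (ContinuousMap.evalAlgHom ℝ ℝ g).commutes a
  | add p q hp hq =>
    simp only [translatePoly, polyFun, map_add, MvPolynomial.eval₂_add] at *
    rw [hp, hq]
  | mul_X p i hp =>
    simp only [translatePoly, polyFun, map_mul, MvPolynomial.eval₂_mul, MvPolynomial.aeval_X,
      MvPolynomial.eval_X, MvPolynomial.eval₂_sum, MvPolynomial.eval₂_C,
      MvPolynomial.eval₂_X] at *
    rw [hp]; rfl

variable [CompactSpace G] [MeasurableSpace G] [BorelSpace G]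

/-- The normalized Haar measure of a compact linear group. -/
def probHaar : Measure G := Measure.haarMeasure ⊤

instance : IsProbabilityMeasure (probHaar G) :=
  ⟨by simpa [probHaar] using Measure.haarMeasure_self (G := G) (K₀ := ⊤)⟩

instance : (probHaar G).IsMulLeftInvariant := by unfold probHaar; infer_instance

/-- Integrating the coefficients of `translatePoly G p` over the group shows that the average is
again a polynomial. Translating by `g⁻¹` makes left invariance of the Haar measure the property
needed. -/
theorem exists_average (p : MvPolynomial (Fin n) ℝ) : ∃ q ∈ invariantAlgebra G, ∀ x,
    polyFun q x = ∫ g : G, polyFun p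
      ((((g⁻¹ : G) : GL (Fin n) ℝ) : Matrix (Fin n) (Fin n) ℝ) *ᵥ x) ∂probHaar G := by
  let Q := translatePoly G p
  let q : MvPolynomial (Fin n) ℝ :=
    ∑ d ∈ Q.support, MvPolynomial.monomial d (∫ g, Q.coeff d g ∂probHaar G)
  have hq : ∀ x, polyFun q x = ∫ g : G, polyFun p
      ((((g⁻¹ : G) : GL (Fin n) ℝ) : Matrix (Fin n) (Fin n) ℝ) *ᵥ x) ∂probHaar G := by
    intro x
    have hint : ∀ c : C(G, ℝ), Integrable (fun g => c g) (probHaar G) := fun c =>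
      c.continuous.integrable_of_hasCompactSupport (HasCompactSupport.of_compactSpace c)
    simp only [← eval_translatePoly, MvPolynomial.eval₂_eq']
    have h1 := integral_finsetSum (μ := probHaar G) Q.support
      (f := fun d g => Q.coeff d g * ∏ i, x i ^ d i) fun d _ => (hint (Q.coeff d)).mul_const _
    refine Eq.trans ?_ h1.symm
    simp only [polyFun, q, map_sum, MvPolynomial.eval_monomial, integral_mul_const]
    refine Finset.sum_congr rfl fun d _ => ?_
    rw [Finsupp.prod_fintype _ _ fun _ => pow_zero _]
  refine ⟨q, fun h hh x => ?_, hq⟩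
  rw [hq, hq]
  rw [← integral_mul_left_eq_self _ (⟨h, hh⟩ : G)]
  refine integral_congr_ae (Eventually.of_forall fun g => ?_)
  simp only
  rw [_root_.mul_inv_rev, mul_action_eq]
  exact congrArg (fun z => polyFun p ((((g⁻¹ : G) : GL (Fin n) ℝ) : Matrix (Fin n) (Fin n) ℝ) *ᵥ z))
    (inv_action_action G ⟨h, hh⟩ x)

end Average

variable {n r : ℕ} {G : Subgroup (GL (Fin n) ℝ)}

theorem exists_polynomial_approx {K : Set (Fin n → ℝ)} (hK : IsCompact K)
    (f : C(Fin n → ℝ, ℝ)) {ε : ℝ} (hε : 0 < ε) :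
    ∃ p : MvPolynomial (Fin n) ℝ, ∀ x ∈ K, |polyFun p x - f x| < ε := by
  let co : Fin n → C(Fin n → ℝ, ℝ) := fun i => ⟨fun x => x i, continuous_apply i⟩
  have hval : ∀ p x, (MvPolynomial.aeval co p : C(Fin n → ℝ, ℝ)) x = polyFun p x := by
    intro p x
    induction p using MvPolynomial.induction_on with
    | C a => simp [polyFun]
    | add p q hp hq => simp only [polyFun, map_add, ContinuousMap.add_apply] at *; rw [hp, hq]
    | mul_X p i hp =>
      simp only [polyFun, map_mul, ContinuousMap.mul_apply, MvPolynomial.aeval_X,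
        MvPolynomial.eval_X] at *
      rw [hp]; rfl
  have hsep : (MvPolynomial.aeval (R := ℝ) co).range.SeparatesPoints := by
    intro x y hxy
    obtain ⟨i, hi⟩ := Function.ne_iff.1 hxy
    exact ⟨co i, ⟨co i, ⟨MvPolynomial.X i, by simp⟩, rfl⟩, hi⟩
  obtain ⟨g, ⟨p, hp⟩, hg⟩ :=
    ContinuousMap.exists_mem_subalgebra_near_continuous_of_isCompact_of_separatesPoints hsep f hK hε
  refine ⟨p, fun x hx => ?_⟩
  rw [← hval]
  have := hg x hx
  rwa [← hp] at this

theorem invariant_eq_polyFun_comp {τ : Fin r → MvPolynomial (Fin n) ℝ}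
    (hτ : Algebra.adjoin ℝ (Set.range τ) = invariantAlgebra G) {p : MvPolynomial (Fin n) ℝ}
    (hp : p ∈ invariantAlgebra G) :
    ∃ P : MvPolynomial (Fin r) ℝ, ∀ x, polyFun p x = polyFun P (polyMap τ x) := by
  rw [← hτ, Algebra.adjoin_range_eq_range_aeval] at hp
  obtain ⟨P, rfl⟩ := hp
  refine ⟨P, fun x => ?_⟩
  simp only [polyFun, AlgHom.toRingHom_eq_coe, RingHom.coe_coe]
  induction P using MvPolynomial.induction_on with
  | C a => simp
  | add p q hp hq => simp only [map_add, hp, hq]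
  | mul_X p i hp => simp only [map_mul, hp, MvPolynomial.aeval_X, MvPolynomial.eval_X]; rfl

/-- The polynomial invariants of a compact group separate the orbits. -/
theorem exists_mem_of_polyMap_eq (hG : IsCompact (G : Set (GL (Fin n) ℝ)))
    {τ : Fin r → MvPolynomial (Fin n) ℝ}
    (hτ : Algebra.adjoin ℝ (Set.range τ) = invariantAlgebra G) {x y : Fin n → ℝ}
    (hxy : polyMap τ x = polyMap τ y) :
    ∃ g ∈ G, (g : Matrix (Fin n) (Fin n) ℝ) *ᵥ x = y := by
  have : CompactSpace G := isCompact_iff_compactSpace.1 hG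
  let _ : MeasurableSpace G := borel G
  have : BorelSpace G := ⟨rfl⟩
  by_contra hne
  push Not at hne
  let orb : (Fin n → ℝ) → Set (Fin n → ℝ) := fun z =>
    Set.range fun g : G => ((g : GL (Fin n) ℝ) : Matrix (Fin n) (Fin n) ℝ) *ᵥ z
  have horb : ∀ z, IsCompact (orb z) := fun z =>
    isCompact_range ((continuous_action G).comp (continuous_id.prodMk continuous_const))
  have hdisj : Disjoint (orb x) (orb y) := by
    rw [Set.disjoint_left]
    rintro _ ⟨g, rfl⟩ ⟨h, hh⟩
    refine hne _ (h⁻¹ * g).2 ?_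
    rw [mul_action_eq]
    exact (congrArg _ hh.symm).trans (inv_action_action G h y)
  -- A function equal to `0` on one orbit and `1` on the other is approximated by a polynomial up to
  -- `1 / 3`. Its average is then at most `1 / 3` at `x` and at least `2 / 3` at `y`, while `polyMap
  -- τ` would force these values to coincide.
  obtain ⟨f, hf0, hf1, -⟩ := exists_continuous_zero_one_of_isClosed (horb x).isClosed
    (horb y).isClosed hdisj
  obtain ⟨p, hp⟩ := exists_polynomial_approx ((horb x).union (horb y)) f
    (show (0 : ℝ) < 1 / 3 by norm_num)
  obtain ⟨q, hqG, hq⟩ := exists_average G p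
  have hint : ∀ z, Integrable (fun g : G => polyFun p
      ((((g⁻¹ : G) : GL (Fin n) ℝ) : Matrix (Fin n) (Fin n) ℝ) *ᵥ z)) (probHaar G) := fun z => by
    refine Continuous.integrable_of_hasCompactSupport ?_ (HasCompactSupport.of_compactSpace _)
    exact (MvPolynomial.continuous_eval p).comp
      ((continuous_action G).comp (continuous_inv.prodMk continuous_const))
  have hx : polyFun q x ≤ 1 / 3 := by
    rw [hq]
    refine (integral_mono (hint x) (integrable_const (1 / 3 : ℝ)) fun g => ?_).trans (by simp)
    have h1 := hp _ (Or.inl ⟨g⁻¹, rfl⟩)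
    rw [hf0 ⟨g⁻¹, rfl⟩] at h1
    have := (abs_lt.1 h1).2
    simp only [Pi.zero_apply, sub_zero] at this
    exact this.le
  have hy : 2 / 3 ≤ polyFun q y := by
    rw [hq]
    refine le_trans (by simp) (integral_mono (integrable_const (2 / 3 : ℝ)) (hint y) fun g => ?_)
    have h1 := hp _ (Or.inr ⟨g⁻¹, rfl⟩)
    rw [hf1 ⟨g⁻¹, rfl⟩] at h1
    have := (abs_lt.1 h1).1
    simp only [Pi.one_apply] at this
    linarith
  obtain ⟨P, hP⟩ := invariant_eq_polyFun_comp hτ hqG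
  rw [hP, hxy, ← hP] at hx
  linarith

/-- The square of the norm given by `S`, as a polynomial. -/
def normSqPoly (S : Matrix (Fin n) (Fin n) ℝ) : MvPolynomial (Fin n) ℝ :=
  ∑ i, ∑ j, MvPolynomial.C (S i j) * MvPolynomial.X i * MvPolynomial.X j

theorem polyFun_normSqPoly (S : Matrix (Fin n) (Fin n) ℝ) (x : Fin n → ℝ) :
    polyFun (normSqPoly S) x = x ⬝ᵥ (S *ᵥ x) := by
  simp only [polyFun, normSqPoly, map_sum, map_mul, MvPolynomial.eval_C, MvPolynomial.eval_X,
    dotProduct, Matrix.mulVec, Finset.mul_sum]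
  exact Finset.sum_congr rfl fun i _ => Finset.sum_congr rfl fun j _ => by ring

theorem normSqPoly_mem {S : Matrix (Fin n) (Fin n) ℝ} (hS : IsInvariantScalarProduct G S) :
    normSqPoly S ∈ invariantAlgebra G := fun g hg x => by
  rw [polyFun_normSqPoly, polyFun_normSqPoly, hS.2 g hg]

theorem isCompact_sublevel_normSq {S : Matrix (Fin n) (Fin n) ℝ} (hS : S.PosDef) (c : ℝ) :
    IsCompact {x : Fin n → ℝ | polyFun (normSqPoly S) x ≤ c} := by
  have hcont : Continuous (polyFun (normSqPoly S)) := MvPolynomial.continuous_eval _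
  refine Metric.isCompact_of_isClosed_isBounded (isClosed_le hcont continuous_const) ?_
  obtain ⟨m, hm, hmle⟩ : ∃ m > 0, ∀ x : Fin n → ℝ, m * ‖x‖ ^ 2 ≤ polyFun (normSqPoly S) x := by
    -- The quadratic form is bounded below by its minimum on the unit sphere; the sphere is empty
    -- only when `n = 0`.
    rcases (Metric.sphere (0 : Fin n → ℝ) 1).eq_empty_or_nonempty with he | hne
    · refine ⟨1, one_pos, fun x => ?_⟩
      by_cases hx : x = 0
      · simp [hx, polyFun_normSqPoly]
      · have : ‖x‖⁻¹ • x ∈ Metric.sphere (0 : Fin n → ℝ) 1 := by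
          rw [mem_sphere_zero_iff_norm, norm_smul, norm_inv, norm_norm,
            inv_mul_cancel₀ (norm_ne_zero_iff.2 hx)]
        rw [he] at this; exact this.elim
    · obtain ⟨u, hu, hmin⟩ := (isCompact_sphere (0 : Fin n → ℝ) 1).exists_isMinOn hne
        hcont.continuousOn
      refine ⟨polyFun (normSqPoly S) u, ?_, fun x => ?_⟩
      · rw [polyFun_normSqPoly]
        have hu0 : u ≠ 0 := by
          rintro rfl
          simp at hu
        simpa using hS.dotProduct_mulVec_pos hu0
      · by_cases hx : x = 0
        · simp [hx, polyFun_normSqPoly]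
        · have hpos : 0 < ‖x‖ := norm_pos_iff.2 hx
          have h1 : ‖x‖⁻¹ • x ∈ Metric.sphere (0 : Fin n → ℝ) 1 := by
            rw [mem_sphere_zero_iff_norm, norm_smul, norm_inv, norm_norm,
              inv_mul_cancel₀ hpos.ne']
          have h2 : polyFun (normSqPoly S) u ≤ polyFun (normSqPoly S) (‖x‖⁻¹ • x) := hmin h1
          have h3 : polyFun (normSqPoly S) (‖x‖⁻¹ • x) * ‖x‖ ^ 2 = polyFun (normSqPoly S) x := by
            simp only [polyFun_normSqPoly, Matrix.mulVec_smul, smul_dotProduct, dotProduct_smul,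
              smul_eq_mul]
            field_simp
          rw [← h3]
          gcongr
  refine isBounded_iff_forall_norm_le.2 ⟨Real.sqrt (c / m), fun x hx => ?_⟩
  refine Real.le_sqrt_of_sq_le ?_
  rw [le_div_iff₀ hm, mul_comm]
  exact (hmle x).trans hx

/-- If the invariants of `y` are close to those of `x`, then the orbit of `y` comes close to `x`. -/
theorem exists_orbit_mem_of_polyMap_near (hG : IsCompact (G : Set (GL (Fin n) ℝ)))
    {S : Matrix (Fin n) (Fin n) ℝ} (hS : IsInvariantScalarProduct G S)
    {τ : Fin r → MvPolynomial (Fin n) ℝ}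
    (hτ : Algebra.adjoin ℝ (Set.range τ) = invariantAlgebra G) {x : Fin n → ℝ}
    {N : Set (Fin n → ℝ)} (hN : IsOpen N) (hx : x ∈ N) :
    ∃ ε > 0, ∀ y, dist (polyMap τ y) (polyMap τ x) < ε →
      ∃ g ∈ G, (g : Matrix (Fin n) (Fin n) ℝ) *ᵥ y ∈ N := by
  have hΨ : Continuous (polyMap τ) := continuous_pi fun l => MvPolynomial.continuous_eval (τ l)
  obtain ⟨P, hP⟩ := invariant_eq_polyFun_comp hτ (normSqPoly_mem hS)
  -- The saturation of `N`. Outside it, a sublevel set of the invariant norm is compact, and its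
  -- image avoids `polyMap τ x` since invariants separate orbits. The norm is itself a polynomial in
  -- the invariants, so points with invariants close to those of `x` lie in that sublevel set.
  let O : Set (Fin n → ℝ) := {y | ∃ g ∈ G, (g : Matrix (Fin n) (Fin n) ℝ) *ᵥ y ∈ N}
  have hO : IsOpen O := by
    have : O = ⋃ g ∈ G, (fun y => (g : Matrix (Fin n) (Fin n) ℝ) *ᵥ y) ⁻¹' N := by
      ext y; simp [O]
    rw [this]
    exact isOpen_biUnion fun g _ => hN.preimage (continuous_const.matrix_mulVec continuous_id)
  have hK := (isCompact_sublevel_normSq hS.1 (polyFun (normSqPoly S) x + 1)).diff hO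
  have hxK : polyMap τ x ∉ polyMap τ '' ({y | polyFun (normSqPoly S) y ≤
      polyFun (normSqPoly S) x + 1} \ O) := by
    rintro ⟨y, hy, hyx⟩
    obtain ⟨g, hg, hgy⟩ := exists_mem_of_polyMap_eq hG hτ hyx
    exact hy.2 ⟨g, hg, by rw [hgy]; exact hx⟩
  have h1 := (hK.image hΨ).isClosed.isOpen_compl.mem_nhds hxK
  have h2 : {z | polyFun P z < polyFun P (polyMap τ x) + 1} ∈ 𝓝 (polyMap τ x) :=
    (isOpen_lt (MvPolynomial.continuous_eval P) continuous_const).mem_nhds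
      (show polyFun P (polyMap τ x) < polyFun P (polyMap τ x) + 1 from lt_add_one _)
  obtain ⟨ε, hε, hsub⟩ := Metric.mem_nhds_iff.1 (inter_mem h1 h2)
  refine ⟨ε, hε, fun y hy => ?_⟩
  by_contra hyO
  obtain ⟨h3, h4⟩ := hsub (Metric.mem_ball.2 hy)
  refine h3 ⟨y, ⟨?_, hyO⟩, rfl⟩
  change polyFun (normSqPoly S) y ≤ polyFun (normSqPoly S) x + 1
  rw [hP, hP]
  exact le_of_lt h4

end

/-! ### Analytic factorization of invariant functions through the generating invariants. -/

section

variable {n s r : ℕ} {G : Subgroup (GL (Fin n) ℝ)} {S : Matrix (Fin n) (Fin n) ℝ}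
  {B : Fin s → Matrix (Fin n) (Fin n) ℝ} {σ : Fin (n - s) → MvPolynomial (Fin n) ℝ}

theorem polyMap_invariant {k : ℕ} {τ : Fin k → MvPolynomial (Fin n) ℝ}
    (hτ : ∀ l, τ l ∈ invariantAlgebra G) {g : GL (Fin n) ℝ} (hg : g ∈ G) (x : Fin n → ℝ) :
    polyMap τ ((g : Matrix (Fin n) (Fin n) ℝ) *ᵥ x) = polyMap τ x :=
  funext fun l => hτ l g hg x

theorem generator_mem {τ : Fin r → MvPolynomial (Fin n) ℝ}
    (hτ : Algebra.adjoin ℝ (Set.range τ) = invariantAlgebra G) (l : Fin r) :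
    τ l ∈ invariantAlgebra G := by
  rw [← hτ]; exact Algebra.subset_adjoin ⟨l, rfl⟩

namespace IsOrbitFrame

variable (H : IsOrbitFrame G S B σ)
include H

theorem exists_polyMap_factor {τ : Fin r → MvPolynomial (Fin n) ℝ}
    (hτ : Algebra.adjoin ℝ (Set.range τ) = invariantAlgebra G) :
    ∃ P : Fin (n - s) → MvPolynomial (Fin r) ℝ,
      ∀ x, polyMap σ x = polyMap P (polyMap τ x) := by
  choose P hP using fun j => invariant_eq_polyFun_comp hτ (H.invariant j)
  exact ⟨P, fun x => funext fun j => hP j x⟩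

/-- Local analytic sections of the map `σ`, together with a neighbourhood of the invariants of `x`
in which the fibres of `σ` determine the values of all invariants. -/
theorem exists_local_section (hG : IsCompact (G : Set (GL (Fin n) ℝ)))
    {τ : Fin r → MvPolynomial (Fin n) ℝ}
    (hτ : Algebra.adjoin ℝ (Set.range τ) = invariantAlgebra G)
    {P : Fin (n - s) → MvPolynomial (Fin r) ℝ}
    (hP : ∀ x, polyMap σ x = polyMap P (polyMap τ x))
    {V : Set (Fin n → ℝ)} (hV : IsOpen V) (hθ : ∀ x ∈ V, theta S B σ x ≠ 0)
    {x : Fin n → ℝ} (hx : x ∈ V) :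
    ∃ (sec : (Fin (n - s) → ℝ) → Fin n → ℝ) (ε δ : ℝ), 0 < δ ∧ δ ≤ ε ∧
      sec (polyMap P (polyMap τ x)) = x ∧
      (∀ y, dist y (polyMap τ x) < δ → AnalyticAt ℝ sec (polyMap P y) ∧
        sec (polyMap P y) ∈ V ∧ polyMap σ (sec (polyMap P y)) = polyMap P y ∧
        dist (polyMap τ (sec (polyMap P y))) (polyMap τ x) < ε) ∧
      ∀ y z, dist (polyMap τ y) (polyMap τ x) < 4 * ε → dist (polyMap τ z) (polyMap τ x) < 4 * ε →
        polyMap σ y = polyMap σ z → polyMap τ y = polyMap τ z := by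
  obtain ⟨c, hcV⟩ := H.exists_fibreChart hV hx (hθ x hx)
  obtain ⟨ε, hε, hεN⟩ := exists_orbit_mem_of_polyMap_near hG H.scalar hτ c.isOpen_N c.mem_N
  have hτG := generator_mem hτ
  have hσ0 : polyMap P (polyMap τ x) = polyMap σ x := (hP x).symm
  let sec : (Fin (n - s) → ℝ) → Fin n → ℝ := fun u => c.ψ (u, c.ℓ x)
  have hsec0 : sec (polyMap σ x) = x := c.ψ_eq x c.mem_N
  have hmem : ∀ u ∈ Metric.ball (polyMap σ x) c.δ,
      (u, c.ℓ x) ∈ Metric.ball (polyMap σ x, c.ℓ x) c.δ := fun u hu => by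
    rw [Metric.mem_ball, Prod.dist_eq, max_lt_iff]
    exact ⟨hu, by simpa using c.δ_pos⟩
  have hsecan : ∀ u ∈ Metric.ball (polyMap σ x) c.δ, AnalyticAt ℝ sec u := fun u hu =>
    (c.analytic _ (hmem u hu)).comp_of_eq (analyticAt_id.prod analyticAt_const) rfl
  have hPc : ContinuousAt (polyMap P) (polyMap τ x) := (analyticAt_polyMap P _).continuousAt
  have h1 : ∀ᶠ y in 𝓝 (polyMap τ x), polyMap P y ∈ Metric.ball (polyMap σ x) c.δ :=
    hPc.eventually_mem (by rw [hσ0]; exact Metric.ball_mem_nhds _ c.δ_pos)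
  have h2 : ∀ᶠ y in 𝓝 (polyMap τ x),
      polyMap τ (sec (polyMap P y)) ∈ Metric.ball (polyMap τ x) (ε / 4) := by
    have hc : ContinuousAt (fun y => polyMap τ (sec (polyMap P y))) (polyMap τ x) := by
      refine ContinuousAt.comp (g := polyMap τ) (f := fun y => sec (polyMap P y))
        (analyticAt_polyMap τ _).continuousAt ?_
      refine ContinuousAt.comp (g := sec) ?_ hPc
      rw [hσ0]
      exact (hsecan _ (Metric.mem_ball_self c.δ_pos)).continuousAt
    refine hc.eventually_mem ?_
    rw [hσ0, hsec0]
    exact Metric.ball_mem_nhds _ (by positivity)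
  obtain ⟨δ, hδ, hsub⟩ := Metric.eventually_nhds_iff_ball.1 (h1.and h2)
  -- The radius is divided by four because gluing compares points whose invariants are at distance
  -- up to three of these radii; four of them still lie within the original `ε`.
  refine ⟨sec, ε / 4, min δ (ε / 4), lt_min hδ (by positivity), min_le_right _ _,
    by rw [hσ0, hsec0], fun y hy => ?_, fun y z hy hz hyz => ?_⟩
  · obtain ⟨hy1, hy2⟩ := hsub y (Metric.mem_ball.2 (hy.trans_le (min_le_left _ _)))
    exact ⟨hsecan _ hy1, hcV (c.mapsTo (hmem _ hy1)), c.polyMap_ψ _ (hmem _ hy1), hy2⟩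
  -- Both points can be moved by the group into the chart, without changing any invariant. There
  -- they lie on one fibre of `σ`, along which every invariant polynomial is constant.
  · obtain ⟨g, hg, hgy⟩ := hεN y (by linarith)
    obtain ⟨g', hg', hgz⟩ := hεN z (by linarith)
    have hfib : polyMap σ ((g : Matrix (Fin n) (Fin n) ℝ) *ᵥ y) =
        polyMap σ ((g' : Matrix (Fin n) (Fin n) ℝ) *ᵥ z) := by
      rw [polyMap_invariant H.invariant hg, polyMap_invariant H.invariant hg', hyz]
    rw [← polyMap_invariant hτG hg, ← polyMap_invariant hτG hg' z]
    funext l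
    refine H.eq_of_fderiv_eq_zero c (fun w hw => hθ w (hcV hw)) (φ := polyFun (τ l))
      (fun w _ => (analyticAt_polyFun _ w).differentiableAt) (fun w _ i => ?_) hgy hgz hfib
    exact (invariantOn_polyFun (hτG l) Set.univ).fderiv_eq_zero isOpen_univ (H.mem_lieAlg i)
      (Set.mem_univ _) (analyticAt_polyFun _ w).differentiableAt

/-- An analytic invariant function on `V` is an analytic function of the generating polynomial
invariants. -/
theorem exists_analytic_factor (hG : IsCompact (G : Set (GL (Fin n) ℝ)))
    {τ : Fin r → MvPolynomial (Fin n) ℝ}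
    (hτ : Algebra.adjoin ℝ (Set.range τ) = invariantAlgebra G)
    {V : Set (Fin n → ℝ)} (hV : IsOpen V) (hθ : ∀ x ∈ V, theta S B σ x ≠ 0)
    {F : Type*} [NormedAddCommGroup F] [NormedSpace ℝ F]
    {φ : (Fin n → ℝ) → F} (hφ : AnalyticOnNhd ℝ φ V)
    (hinv : ∀ g ∈ G, ∀ x ∈ V, (g : Matrix (Fin n) (Fin n) ℝ) *ᵥ x ∈ V →
      φ ((g : Matrix (Fin n) (Fin n) ℝ) *ᵥ x) = φ x) :
    ∃ (W : Set (Fin r → ℝ)) (h : (Fin r → ℝ) → F), IsOpen W ∧ Set.MapsTo (polyMap τ) V W ∧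
      AnalyticOnNhd ℝ h W ∧ ∀ x ∈ V, h (polyMap τ x) = φ x := by
  obtain ⟨P, hP⟩ := H.exists_polyMap_factor hτ
  choose! sec ε δ hδ hδε hsecx hsec hinj using
    fun x (hx : x ∈ V) => H.exists_local_section hG hτ hP hV hθ hx
  -- Two local factors agree where both are defined, even at `y` outside the image of `polyMap τ`.
  -- The two section points have equal `σ`, hence equal generating invariants, hence lie on one
  -- orbit, and both belong to `V`. The assumption on the radii is removed by symmetry.
  have key : ∀ x ∈ V, ∀ x' ∈ V, ∀ y, dist y (polyMap τ x) < δ x → dist y (polyMap τ x') < δ x' →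
      ε x' ≤ ε x → φ (sec x (polyMap P y)) = φ (sec x' (polyMap P y)) := by
    intro x hx x' hx' y hy hy' hle
    obtain ⟨-, h1, h2, h3⟩ := hsec x hx y hy
    obtain ⟨-, h1', h2', h3'⟩ := hsec x' hx' y hy'
    have hd := hδε x hx
    have hd' := hδε x' hx'
    have h0 := hδ x hx
    have e : polyMap τ (sec x (polyMap P y)) = polyMap τ (sec x' (polyMap P y)) := by
      refine hinj x hx _ _ (by linarith) ?_ (by rw [h2, h2'])
      have t1 := dist_triangle (polyMap τ (sec x' (polyMap P y))) (polyMap τ x') (polyMap τ x)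
      have t2 := dist_triangle (polyMap τ x') y (polyMap τ x)
      rw [dist_comm (polyMap τ x') y] at t2
      linarith
    obtain ⟨g, hg, hgx⟩ := exists_mem_of_polyMap_eq hG hτ e
    have := hinv g hg _ h1 (by rw [hgx]; exact h1')
    rw [← this, hgx]
  have key' : ∀ x ∈ V, ∀ x' ∈ V, ∀ y, dist y (polyMap τ x) < δ x → dist y (polyMap τ x') < δ x' →
      φ (sec x (polyMap P y)) = φ (sec x' (polyMap P y)) := by
    intro x hx x' hx' y hy hy'
    rcases le_total (ε x') (ε x) with hle | hle
    · exact key x hx x' hx' y hy hy' hle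
    · exact (key x' hx' x hx y hy' hy hle).symm
  let W : Set (Fin r → ℝ) := ⋃ x ∈ V, Metric.ball (polyMap τ x) (δ x)
  have hWx : ∀ y ∈ W, ∃ x ∈ V, dist y (polyMap τ x) < δ x := fun y hy => by
    simpa [W] using hy
  choose! base hbase hbased using hWx
  refine ⟨W, fun y => φ (sec (base y) (polyMap P y)), isOpen_biUnion fun _ _ => Metric.isOpen_ball,
    fun x hx => Set.mem_biUnion hx (Metric.mem_ball_self (hδ x hx)), fun y hy => ?_, fun x hx => ?_⟩
  · obtain ⟨x, hx, hxy⟩ : ∃ x ∈ V, dist y (polyMap τ x) < δ x := ⟨_, hbase y hy, hbased y hy⟩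
    obtain ⟨h1, h2, -, -⟩ := hsec x hx y hxy
    have han : AnalyticAt ℝ (fun y => φ (sec x (polyMap P y))) y :=
      (hφ _ h2).comp_of_eq (h1.comp_of_eq (analyticAt_polyMap P y) rfl) rfl
    refine han.congr ?_
    filter_upwards [Metric.isOpen_ball.mem_nhds (Metric.mem_ball.2 hxy)] with z hz
    have hzW : z ∈ W := Set.mem_biUnion hx hz
    exact key' x hx _ (hbase z hzW) z hz (hbased z hzW)
  · have hxW : polyMap τ x ∈ W := Set.mem_biUnion hx (Metric.mem_ball_self (hδ x hx))
    have := key' x hx _ (hbase _ hxW) _ (Metric.mem_ball_self (hδ x hx)) (hbased _ hxW)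
    simp only
    rw [← this, hsecx x hx]

end IsOrbitFrame

end

/-! ### Reducibility and symmetry in terms of the coefficients; proof of (a). -/

section

variable {n s r : ℕ} {G : Subgroup (GL (Fin n) ℝ)} {S : Matrix (Fin n) (Fin n) ℝ}
  {B : Fin s → Matrix (Fin n) (Fin n) ℝ} {σ : Fin (n - s) → MvPolynomial (Fin n) ℝ}

theorem exists_isSolution {f : (Fin n → ℝ) → Fin n → ℝ} {V : Set (Fin n → ℝ)} (hV : IsOpen V)
    {x : Fin n → ℝ} (hx : x ∈ V) (hf : AnalyticAt ℝ f x) :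
    ∃ (I : Set ℝ) (γ : ℝ → Fin n → ℝ), IsSolution f V I γ ∧ (0 : ℝ) ∈ I ∧ γ 0 = x := by
  obtain ⟨γ, hγ0, ε, hε, hγ⟩ := ContDiffAt.exists_forall_mem_closedBall_exists_eq_forall_mem_Ioo_hasDerivAt₀
    (hf.contDiffAt (n := 1)) 0
  have h0 : (0 : ℝ) ∈ Set.Ioo (0 - ε) (0 + ε) := by simp [hε]
  have hc : ContinuousAt γ 0 := (hγ 0 h0).continuousAt
  have hev : ∀ᶠ t in 𝓝 (0 : ℝ), γ t ∈ V := hc.eventually_mem (by rw [hγ0]; exact hV.mem_nhds hx)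
  obtain ⟨δ, hδ, hsub⟩ := Metric.eventually_nhds_iff_ball.1 hev
  refine ⟨Set.Ioo (-(min ε δ)) (min ε δ), γ, ⟨isOpen_Ioo, Set.ordConnected_Ioo, fun t ht => ?_⟩,
    by simp [hε, hδ], hγ0⟩
  obtain ⟨h1, h2⟩ := ht
  have h3 := min_le_left ε δ
  have h4 := min_le_right ε δ
  refine ⟨hsub t ?_, hγ t ⟨by linarith, by linarith⟩⟩
  rw [Metric.mem_ball, Real.dist_eq, sub_zero, abs_lt]
  exact ⟨by linarith, by linarith⟩

/-- A map which sends solutions to solutions relates the vector fields. -/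
theorem MapsSolutions.fderiv_apply {Φ : (Fin n → ℝ) → Fin r → ℝ} {f : (Fin n → ℝ) → Fin n → ℝ}
    {V : Set (Fin n → ℝ)} {h : (Fin r → ℝ) → Fin r → ℝ} {W : Set (Fin r → ℝ)}
    (hΦ : MapsSolutions Φ f V h W) (hV : IsOpen V) (hW : IsOpen W) {x : Fin n → ℝ} (hx : x ∈ V)
    (hf : AnalyticAt ℝ f x) (hd : DifferentiableAt ℝ Φ x) (hxW : Φ x ∈ W) :
    fderiv ℝ Φ x (f x) = h (Φ x) := by
  have hc : ∀ᶠ y in 𝓝 x, Φ y ∈ W := hd.continuousAt.eventually_mem (hW.mem_nhds hxW)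
  -- Shrinking the domain keeps the image of the solution in `W`, as `MapsSolutions` requires.
  obtain ⟨V', hV'sub, hV'o, hxV'⟩ := mem_nhds_iff.1 (inter_mem (hV.mem_nhds hx) hc)
  obtain ⟨I, γ, hγ, h0, rfl⟩ := exists_isSolution hV'o hxV' hf
  have h1 := hΦ I γ ⟨hγ.1, hγ.2.1, fun t ht => ⟨(hV'sub (hγ.2.2 t ht).1).1, (hγ.2.2 t ht).2⟩⟩
    fun t ht => (hV'sub (hγ.2.2 t ht).1).2
  exact (hd.hasFDerivAt.comp_hasDerivAt 0 (hγ.2.2 0 h0).2).unique (h1.2.2 0 h0).2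

theorem mapsSolutions_of_fderiv_apply {Φ : (Fin n → ℝ) → Fin r → ℝ} {f : (Fin n → ℝ) → Fin n → ℝ}
    {V : Set (Fin n → ℝ)} {h : (Fin r → ℝ) → Fin r → ℝ} {W : Set (Fin r → ℝ)}
    (hd : ∀ x ∈ V, DifferentiableAt ℝ Φ x)
    (hΦ : ∀ x ∈ V, Φ x ∈ W → fderiv ℝ Φ x (f x) = h (Φ x)) : MapsSolutions Φ f V h W := by
  intro I γ hγ hW
  refine ⟨hγ.1, hγ.2.1, fun t ht => ⟨hW t ht, ?_⟩⟩
  obtain ⟨h1, h2⟩ := hγ.2.2 t ht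
  exact ((hd _ h1).hasFDerivAt.comp_hasDerivAt t h2).congr_deriv (hΦ _ h1 (hW t ht))

theorem fderiv_polyMap_comp {τ : Fin r → MvPolynomial (Fin n) ℝ}
    {P : Fin (n - s) → MvPolynomial (Fin r) ℝ}
    (hP : ∀ x, polyMap σ x = polyMap P (polyMap τ x)) (x v : Fin n → ℝ) :
    fderiv ℝ (polyMap σ) x v =
      fderiv ℝ (polyMap P) (polyMap τ x) (fderiv ℝ (polyMap τ) x v) := by
  have h1 := (analyticAt_polyMap P (polyMap τ x)).differentiableAt.hasFDerivAt.comp x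
    (analyticAt_polyMap τ x).differentiableAt.hasFDerivAt
  rw [show polyMap P ∘ polyMap τ = polyMap σ from funext fun x => (hP x).symm] at h1
  rw [h1.fderiv]; rfl

theorem analyticOnNhd_gradPart {V : Set (Fin n → ℝ)} {β : Fin (n - s) → (Fin n → ℝ) → ℝ}
    (hβ : ∀ j, AnalyticOnNhd ℝ (β j) V) : AnalyticOnNhd ℝ (gradPart S σ β) V := fun x hx =>
  Finset.analyticAt_fun_sum _ fun j _ => (hβ j x hx).smul (analyticAt_gradField S (σ j) x)

namespace IsOrbitFrame

variable (H : IsOrbitFrame G S B σ)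
include H

/-- If `s = n`, then `x` is a combination of the `B i x`. These are orthogonal to `x`, so `x = 0`
and `B i x = 0`, against linear independence. This makes the rank `n - s` positive, as reducibility
demands. -/
theorem lt_of_theta_ne_zero (hs0 : 0 < s) {x : Fin n → ℝ} (hθ : theta S B σ x ≠ 0) : s < n := by
  refine lt_of_le_of_ne H.le fun hsn => ?_
  obtain ⟨a, b, hab⟩ := H.exists_coeff hθ x
  have : IsEmpty (Fin (n - s)) := by rw [hsn, Nat.sub_self]; infer_instance
  have hxx : x ⬝ᵥ (S *ᵥ x) = 0 := by
    conv_lhs => arg 2; rw [hab]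
    rw [Finset.univ_eq_empty (α := Fin (n - s)), Finset.sum_empty, add_zero, Matrix.mulVec_sum,
      dotProduct_sum]
    simp only [Matrix.mulVec_smul, dotProduct_smul,
      linField_orthogonal_self H.scalar (H.mem_lieAlg _), smul_zero, Finset.sum_const_zero]
  have hx : x = 0 := by
    by_contra hne
    have := H.scalar.1.dotProduct_mulVec_pos hne
    simp only [star_trivial] at this
    exact this.ne' hxx
  refine (linField_linearIndependent H.le hθ).ne_zero ⟨0, hs0⟩ ?_
  simp [hx, linField]

theorem fderiv_polyMap_linField {τ : Fin r → MvPolynomial (Fin n) ℝ}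
    (hτ : ∀ l, τ l ∈ invariantAlgebra G) (x : Fin n → ℝ) (i : Fin s) :
    fderiv ℝ (polyMap τ) x (linField (B i) x) = 0 := by
  funext l
  rw [fderiv_polyMap_apply, gradField_spec H.scalar.1]
  exact gradField_orthogonal H.scalar.1 (hτ l) (H.mem_lieAlg i) x

/-- Since `σ` factors through the generators, a vector killed by their derivative is orthogonal to
all gradients. The kernel is therefore exactly the tangent space of the orbit. -/
theorem finrank_range_fderiv {τ : Fin r → MvPolynomial (Fin n) ℝ}
    (hτ : Algebra.adjoin ℝ (Set.range τ) = invariantAlgebra G) {x : Fin n → ℝ}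
    (hθ : theta S B σ x ≠ 0) :
    Module.finrank ℝ (LinearMap.range (fderiv ℝ (polyMap τ) x).toLinearMap) = n - s := by
  obtain ⟨P, hP⟩ := H.exists_polyMap_factor hτ
  have hker : LinearMap.ker (fderiv ℝ (polyMap τ) x).toLinearMap =
      Submodule.span ℝ (Set.range fun i => linField (B i) x) := by
    refine le_antisymm (fun v hv => ?_) (Submodule.span_le.2 ?_)
    · have hv' : fderiv ℝ (polyMap τ) x v = 0 := hv
      obtain ⟨a, ha⟩ := H.exists_coeff_of_orthogonal hθ (v := v) fun j => by
        rw [← gradField_spec H.scalar.1, ← fderiv_polyMap_apply, fderiv_polyMap_comp hP, hv',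
          map_zero]; rfl
      rw [ha]
      exact Submodule.sum_mem _ fun i _ =>
        Submodule.smul_mem _ _ (Submodule.subset_span ⟨i, rfl⟩)
    · rintro _ ⟨i, rfl⟩
      exact H.fderiv_polyMap_linField (generator_mem hτ) x i
  have h1 := LinearMap.finrank_range_add_finrank_ker (fderiv ℝ (polyMap τ) x).toLinearMap
  rw [hker, finrank_span_eq_card (linField_linearIndependent H.le hθ)] at h1
  simp only [Fintype.card_fin, Module.finrank_fintype_fun_eq_card] at h1
  omega

theorem gradPart_equivariant {V : Set (Fin n → ℝ)} {β : Fin (n - s) → (Fin n → ℝ) → ℝ}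
    (hβ : ∀ j, InvariantOn G V (β j)) {g : GL (Fin n) ℝ} (hg : g ∈ G) {x : Fin n → ℝ} (hx : x ∈ V)
    (hgx : (g : Matrix (Fin n) (Fin n) ℝ) *ᵥ x ∈ V) :
    gradPart S σ β ((g : Matrix (Fin n) (Fin n) ℝ) *ᵥ x) =
      (g : Matrix (Fin n) (Fin n) ℝ) *ᵥ gradPart S σ β x := by
  simp only [gradPart, Matrix.mulVec_sum, Matrix.mulVec_smul,
    gradField_equivariant H.scalar (H.invariant _) hg, hβ _ g hg x hx hgx]

theorem analyticOnNhd_coeff {V : Set (Fin n → ℝ)} (hV : IsOpen V)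
    (hθ : ∀ x ∈ V, theta S B σ x ≠ 0) {f : (Fin n → ℝ) → Fin n → ℝ} (hf : AnalyticOnNhd ℝ f V)
    {α : Fin s → (Fin n → ℝ) → ℝ} {β : Fin (n - s) → (Fin n → ℝ) → ℝ}
    (hrep : ∀ x ∈ V, f x = ∑ i, α i x • linField (B i) x + gradPart S σ β x) :
    (∀ i, AnalyticOnNhd ℝ (α i) V) ∧ ∀ j, AnalyticOnNhd ℝ (β j) V := by
  have h : ∀ k, AnalyticOnNhd ℝ (Sum.elim α β k) V := fun k x hx => by
    refine analyticAt_frame_coeff H.le (ψ := fun x => x) analyticAt_id (hf x hx) (hθ x hx)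
      (c := Sum.elim α β) ?_ k
    filter_upwards [hV.mem_nhds hx] with y hy
    rw [hrep y hy, Fintype.sum_sum_type]; rfl
  exact ⟨fun i => h (.inl i), fun j => h (.inr j)⟩

theorem fderiv_polyMap_eq {τ : Fin r → MvPolynomial (Fin n) ℝ}
    (hτ : ∀ l, τ l ∈ invariantAlgebra G) {x : Fin n → ℝ} {f : (Fin n → ℝ) → Fin n → ℝ}
    {α : Fin s → (Fin n → ℝ) → ℝ} {β : Fin (n - s) → (Fin n → ℝ) → ℝ}
    (hrep : f x = ∑ i, α i x • linField (B i) x + gradPart S σ β x) (l : Fin r) :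
    fderiv ℝ (polyMap τ) x (f x) l = gradField S (τ l) x ⬝ᵥ (S *ᵥ gradPart S σ β x) := by
  rw [fderiv_polyMap_apply, gradField_spec H.scalar.1, hrep, H.dotProduct_decomp (hτ l)]

theorem reducibleBy_iff (hG : IsCompact (G : Set (GL (Fin n) ℝ))) (hs0 : 0 < s)
    {τ : Fin r → MvPolynomial (Fin n) ℝ}
    (hτ : Algebra.adjoin ℝ (Set.range τ) = invariantAlgebra G)
    {V : Set (Fin n → ℝ)} (hV : IsOpen V) (hVne : V.Nonempty)
    (hθ : ∀ x ∈ V, theta S B σ x ≠ 0) {f : (Fin n → ℝ) → Fin n → ℝ} (hf : AnalyticOnNhd ℝ f V)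
    {α : Fin s → (Fin n → ℝ) → ℝ} {β : Fin (n - s) → (Fin n → ℝ) → ℝ}
    (hrep : ∀ x ∈ V, f x = ∑ i, α i x • linField (B i) x + gradPart S σ β x) :
    ReducibleBy (polyMap τ) f V ↔ ∀ j, InvariantOn G V (β j) := by
  have hτG := generator_mem hτ
  constructor
  · rintro ⟨-, -, W, h, hW, hVW, hh, hmaps⟩ j g hg x hx hgx
    obtain ⟨P, hP⟩ := H.exists_polyMap_factor hτ
    have h1 : ∀ y ∈ V, fderiv ℝ (polyMap σ) y (f y) =
        fderiv ℝ (polyMap P) (polyMap τ y) (h (polyMap τ y)) := fun y hy => by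
      rw [fderiv_polyMap_comp hP, hmaps.fderiv_apply hV hW hy (hf y hy)
        (analyticAt_polyMap τ y).differentiableAt (hVW hy)]
    -- The derivative of `σ` along `f` depends only on `polyMap τ`, hence agrees at `x` and `g x`.
    -- Pulling the gradients back from `g x` by equivariance turns this into orthogonality of the
    -- difference vector to every gradient.
    have h2 : ∀ k, gradField S (σ k) x ⬝ᵥ (S *ᵥ ∑ j,
        (β j ((g : Matrix (Fin n) (Fin n) ℝ) *ᵥ x) - β j x) • gradField S (σ j) x) = 0 := by
      intro k
      have e1 := congrFun (h1 _ hgx) k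
      rw [polyMap_invariant hτG hg, ← h1 x hx, H.fderiv_polyMap_eq H.invariant (hrep _ hgx),
        H.fderiv_polyMap_eq H.invariant (hrep _ hx)] at e1
      have e2 : gradPart S σ β ((g : Matrix (Fin n) (Fin n) ℝ) *ᵥ x) =
          (g : Matrix (Fin n) (Fin n) ℝ) *ᵥ
            ∑ j, β j ((g : Matrix (Fin n) (Fin n) ℝ) *ᵥ x) • gradField S (σ j) x := by
        simp only [gradPart, Matrix.mulVec_sum, Matrix.mulVec_smul,
          gradField_equivariant H.scalar (H.invariant _) hg]
      rw [e2, gradField_equivariant H.scalar (H.invariant k) hg, H.scalar.2 g hg] at e1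
      simp only [sub_smul, Finset.sum_sub_distrib, Matrix.mulVec_sub, dotProduct_sub]
      rw [e1]; exact sub_self _
    set w := ∑ j, (β j ((g : Matrix (Fin n) (Fin n) ℝ) *ᵥ x) - β j x) • gradField S (σ j) x
      with hw
    have hww : w ⬝ᵥ (S *ᵥ w) = 0 := by
      conv_lhs => arg 1; rw [hw]
      rw [sum_dotProduct]
      simp [h2]
    have hw0 : w = 0 := by
      by_contra hne
      have := H.scalar.1.dotProduct_mulVec_pos hne
      simp only [star_trivial] at this
      exact this.ne' hww
    exact sub_eq_zero.1 (Fintype.linearIndependent_iff.1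
      (gradField_linearIndependent H.le (hθ x hx)) _ hw0 j)
  · intro hβ
    obtain ⟨x₀, hx₀⟩ := hVne
    have hsn := H.lt_of_theta_ne_zero hs0 (hθ x₀ hx₀)
    -- The reduced field is the factor of `DΨ · f`. This function sees only `gradPart`, so it is
    -- invariant once the coefficients are.
    obtain ⟨W, h, hW, hVW, hh, hhφ⟩ := H.exists_analytic_factor hG hτ hV hθ
      (φ := fun x => fderiv ℝ (polyMap τ) x (f x)) (fun x hx => by
        have h1 : AnalyticAt ℝ (fderiv ℝ (polyMap τ)) x := (analyticAt_polyMap τ x).fderiv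
        exact (ContinuousLinearMap.analyticAt_bilinear
          (ContinuousLinearMap.id ℝ ((Fin n → ℝ) →L[ℝ] (Fin r → ℝ))) _).comp₂ h1 (hf x hx))
      (fun g hg x hx hgx => by
        funext l
        rw [H.fderiv_polyMap_eq hτG (hrep _ hgx), H.fderiv_polyMap_eq hτG (hrep _ hx),
          H.gradPart_equivariant hβ hg hx hgx, gradField_equivariant H.scalar (hτG l) hg,
          H.scalar.2 g hg])
    refine ⟨fun x _ => analyticAt_polyMap τ x, ⟨n - s, by omega, by omega, fun x hx =>
      (H.finrank_range_fderiv hτ (hθ x hx)).le, x₀, hx₀, H.finrank_range_fderiv hτ (hθ x₀ hx₀)⟩,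
      W, h, hW, hVW, hh, ?_⟩
    exact mapsSolutions_of_fderiv_apply (fun x _ => (analyticAt_polyMap τ x).differentiableAt)
      fun x hx _ => (hhφ x hx).symm

theorem symmetricOn_iff {V : Set (Fin n → ℝ)} (hV : IsOpen V)
    (hθ : ∀ x ∈ V, theta S B σ x ≠ 0) {β : Fin (n - s) → (Fin n → ℝ) → ℝ}
    (hβ : ∀ j, AnalyticOnNhd ℝ (β j) V) :
    (∀ j, InvariantOn G V (β j)) ↔ SymmetricOn G V (gradPart S σ β) := by
  constructor
  · intro hinv g hg
    refine mapsSolutions_of_fderiv_apply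
      (fun x _ => (analyticAt_linField _ x).differentiableAt) fun x hx hgx => ?_
    rw [fderiv_linField]
    exact (H.gradPart_equivariant hinv hg hx hgx).symm
  · intro hsym j g hg x hx hgx
    have h1 := (hsym g hg).fderiv_apply hV hV hx (analyticOnNhd_gradPart hβ x hx)
      (analyticAt_linField _ x).differentiableAt hgx
    rw [fderiv_linField] at h1
    have h2 : (g : Matrix (Fin n) (Fin n) ℝ) *ᵥ gradPart S σ β x =
        ∑ j, β j x • gradField S (σ j) ((g : Matrix (Fin n) (Fin n) ℝ) *ᵥ x) := by
      simp only [gradPart, Matrix.mulVec_sum, Matrix.mulVec_smul,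
        gradField_equivariant H.scalar (H.invariant _) hg]
    rw [h2] at h1
    exact (congrFun (gradField_coeff_unique H.le (hθ _ hgx) h1) j).symm

theorem involutionSystemOn {V : Set (Fin n → ℝ)} (hV : IsOpen V)
    (hθ : ∀ x ∈ V, theta S B σ x ≠ 0) : InvolutionSystemOn (fun i => linField (B i)) V := by
  refine ⟨fun i x _ => analyticAt_linField _ x, ?_⟩
  have h : ∀ i j, ∃ a : Fin s → (Fin n → ℝ) → ℝ, (∀ k, AnalyticOnNhd ℝ (a k) V) ∧
      ∀ x ∈ V, VectorField.lieBracket ℝ (linField (B i)) (linField (B j)) x =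
        ∑ k, a k x • linField (B k) x := by
    intro i j
    refine H.exists_analytic_coeff_of_orthogonal hV (ψ := fun x => x) (fun x _ => analyticAt_id)
      (fun x _ => ?_) hθ
      fun x _ k => lieBracket_linField_orthogonal H.scalar (H.invariant k) (H.mem_lieAlg i)
        (H.mem_lieAlg j) x
    have e : VectorField.lieBracket ℝ (linField (B i)) (linField (B j)) =
        fun x => linField (B j) (linField (B i) x) - linField (B i) (linField (B j) x) := by
      funext x
      simp only [VectorField.lieBracket, fderiv_linField]; rfl
    rw [e]
    exact ((analyticAt_linField _ _).comp (analyticAt_linField _ _)).sub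
      ((analyticAt_linField _ _).comp (analyticAt_linField _ _))
  choose c hc hcB using h
  exact ⟨c, fun i j => hc i j, fun i j => hcB i j⟩

theorem lieBracket_gradPart_eq_zero {V : Set (Fin n → ℝ)} (hV : IsOpen V)
    {β : Fin (n - s) → (Fin n → ℝ) → ℝ} (hβ : ∀ j, AnalyticOnNhd ℝ (β j) V)
    (hinv : ∀ j, InvariantOn G V (β j)) {B' : Matrix (Fin n) (Fin n) ℝ} (hB' : B' ∈ lieAlg G)
    {x : Fin n → ℝ} (hx : x ∈ V) :
    VectorField.lieBracket ℝ (gradPart S σ β) (linField B') x = 0 := by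
  rw [VectorField.lieBracket_swap,
    H.lieBracket_gradPart hB' fun j => (hβ j x hx).differentiableAt]
  simp only [(hinv _).fderiv_eq_zero hV hB' hx (hβ _ x hx).differentiableAt, zero_smul,
    Finset.sum_const_zero, neg_zero]

end IsOrbitFrame

end

/-! ### Orbital reducibility and orbital symmetry; proof of (b). -/

section

theorem eq_of_mem_closure_of_eventually {E F : Type*} [NormedAddCommGroup E]
    [NormedAddCommGroup F] {D : Set E} {y : E} (hy : y ∈ closure D) {u v : E → F}
    (hu : ContinuousAt u y) (hv : ContinuousAt v y) (h : ∀ᶠ z in 𝓝 y, z ∈ D → u z = v z) :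
    u y = v y := by
  by_contra hne
  have h1 : ∀ᶠ z in 𝓝 y, u z ≠ v z := by
    filter_upwards [(hu.sub hv).eventually_ne (sub_ne_zero.2 hne)] with z hz using sub_ne_zero.1 hz
  rw [mem_closure_iff_frequently] at hy
  obtain ⟨z, hz, h2, h3⟩ := (hy.and_eventually (h.and h1)).exists
  exact h3 (h2 hz)

section Density

variable {E F : Type*} [NormedAddCommGroup E] [NormedSpace ℝ E] [NormedAddCommGroup F]
  [NormedSpace ℝ F]

/-- If `b` vanished near a point of the ball, the identity theorem would make it vanish on the whole
ball, which meets the support. The closure of the support is thus relatively open and closed in `V`,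
so definitions by cases on it preserve analyticity. -/
theorem eventually_mem_closure_support {V : Set E} (hV : IsOpen V) {b : E → F}
    (hb : AnalyticOnNhd ℝ b V) {x : E} (hx : x ∈ V) (hxc : x ∈ closure {y ∈ V | b y ≠ 0}) :
    ∀ᶠ y in 𝓝 x, y ∈ closure {y ∈ V | b y ≠ 0} := by
  obtain ⟨ε, hε, hsub⟩ := Metric.isOpen_iff.1 hV x hx
  filter_upwards [Metric.ball_mem_nhds x hε] with y hy
  by_contra hyc
  rw [mem_closure_iff_frequently, not_frequently] at hyc
  have h0 : b =ᶠ[𝓝 y] 0 := by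
    filter_upwards [hyc, hV.mem_nhds (hsub hy)] with z hz hzV
    by_contra hne
    exact hz ⟨hzV, hne⟩
  have h1 := (hb.mono hsub).eqOn_zero_of_preconnected_of_eventuallyEq_zero
    (convex_ball x ε).isPreconnected hy h0
  rw [mem_closure_iff_frequently] at hxc
  obtain ⟨z, hz, hzb⟩ := (hxc.and_eventually (Metric.ball_mem_nhds x hε)).exists
  exact hz.2 (h1 hzb)

end Density

variable {n s r : ℕ} {G : Subgroup (GL (Fin n) ℝ)} {S : Matrix (Fin n) (Fin n) ℝ}
  {B : Fin s → Matrix (Fin n) (Fin n) ℝ} {σ : Fin (n - s) → MvPolynomial (Fin n) ℝ}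
  {V : Set (Fin n → ℝ)} {β : Fin (n - s) → (Fin n → ℝ) → ℝ}

namespace IsOrbitFrame

variable (H : IsOrbitFrame G S B σ)
include H

/-- Part (a) is applied to `μ f`, whose coefficients are `μ β_j`; the factors `μ` and `ν` are
inverse to each other. -/
theorem orbitallyReducibleBy_iff (hG : IsCompact (G : Set (GL (Fin n) ℝ))) (hs0 : 0 < s)
    {τ : Fin r → MvPolynomial (Fin n) ℝ}
    (hτ : Algebra.adjoin ℝ (Set.range τ) = invariantAlgebra G)
    (hV : IsOpen V) (hVne : V.Nonempty)
    (hθ : ∀ x ∈ V, theta S B σ x ≠ 0) {f : (Fin n → ℝ) → Fin n → ℝ} (hf : AnalyticOnNhd ℝ f V)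
    {α : Fin s → (Fin n → ℝ) → ℝ}
    (hrep : ∀ x ∈ V, f x = ∑ i, α i x • linField (B i) x + gradPart S σ β x) :
    OrbitallyReducibleBy (polyMap τ) f V ↔ InvariantUpToFactorOn G V β := by
  have hβ := (H.analyticOnNhd_coeff hV hθ hf hrep).2
  have hiff : ∀ μ : (Fin n → ℝ) → ℝ, AnalyticOnNhd ℝ μ V →
      (ReducibleBy (polyMap τ) (fun x => μ x • f x) V ↔
        ∀ j, InvariantOn G V (fun x => μ x * β j x)) := fun μ hμ =>
    H.reducibleBy_iff hG hs0 hτ hV hVne hθ (hμ.smul hf) (α := fun i x => μ x * α i x)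
      (β := fun j x => μ x * β j x) fun x hx => by
        rw [hrep x hx, smul_add, Finset.smul_sum, gradPart, Finset.smul_sum]
        simp only [smul_smul, gradPart]
  constructor
  · rintro ⟨μ, hμ, hμ0, hred⟩
    refine ⟨fun x => (μ x)⁻¹, fun j x => μ x * β j x, hμ.inv hμ0, fun x hx => inv_ne_zero (hμ0 x hx),
      fun j => ⟨hμ.mul (hβ j), (hiff μ hμ).1 hred j, fun x hx => ?_⟩⟩
    rw [inv_mul_cancel_left₀ (hμ0 x hx)]
  · rintro ⟨ν, β', hν, hν0, h⟩
    refine ⟨fun x => (ν x)⁻¹, hν.inv hν0, fun x hx => inv_ne_zero (hν0 x hx), ?_⟩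
    refine (hiff (fun x => (ν x)⁻¹) (hν.inv hν0)).2 fun j g hg x hx hgx => ?_
    obtain ⟨-, h2, h3⟩ := h j
    simp only
    rw [h3 _ hgx, h3 x hx, inv_mul_cancel_left₀ (hν0 _ hgx), inv_mul_cancel_left₀ (hν0 x hx),
      h2 g hg x hx hgx]

/-- The invariant factors are constant along `B'`, so every coefficient has the logarithmic
derivative of `ν` as its rate. -/
theorem orbitallySymmetricOn_of_invariantUpToFactorOn (hV : IsOpen V)
    (h : InvariantUpToFactorOn G V β) : OrbitallySymmetricOn G V (gradPart S σ β) := by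
  obtain ⟨ν, β', hν, hν0, h⟩ := h
  intro B' hB'
  refine ⟨fun x => fderiv ℝ ν x (linField B' x) / ν x, fun x hx => ?_, fun x hx => ?_⟩
  · refine AnalyticAt.div ?_ (hν x hx) (hν0 x hx)
    exact (ContinuousLinearMap.analyticAt_bilinear
      (ContinuousLinearMap.id ℝ ((Fin n → ℝ) →L[ℝ] ℝ)) _).comp₂ (hν.fderiv x hx)
        (analyticAt_linField B' x)
  · have hd : ∀ j, HasFDerivAt (β j) (ν x • fderiv ℝ (β' j) x + β' j x • fderiv ℝ ν x) x := by
      intro j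
      obtain ⟨h1, -, h3⟩ := h j
      refine ((hν x hx).differentiableAt.hasFDerivAt.mul
        (h1 x hx).differentiableAt.hasFDerivAt).congr_of_eventuallyEq ?_
      filter_upwards [hV.mem_nhds hx] with y hy using h3 y hy
    rw [H.lieBracket_gradPart hB' fun j => (hd j).differentiableAt, gradPart, Finset.smul_sum]
    refine Finset.sum_congr rfl fun j _ => ?_
    obtain ⟨h1, h2, h3⟩ := h j
    rw [(hd j).fderiv, smul_smul, h3 x hx]
    congr 1
    have h4 := h2.fderiv_eq_zero hV hB' hx (h1 x hx).differentiableAt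
    have h5 := hν0 x hx
    simp only [_root_.add_apply, _root_.smul_apply, smul_eq_mul, h4]
    field_simp
    ring

theorem fderiv_coeff_of_orbitallySymmetricOn (hθ : ∀ x ∈ V, theta S B σ x ≠ 0)
    (hβ : ∀ j, AnalyticOnNhd ℝ (β j) V) {B' : Matrix (Fin n) (Fin n) ℝ} (hB' : B' ∈ lieAlg G)
    {a : ℝ} {x : Fin n → ℝ} (hx : x ∈ V)
    (ha : VectorField.lieBracket ℝ (linField B') (gradPart S σ β) x = a • gradPart S σ β x)
    (j : Fin (n - s)) : fderiv ℝ (β j) x (linField B' x) = a * β j x := by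
  rw [H.lieBracket_gradPart hB' fun j => (hβ j x hx).differentiableAt, gradPart,
    Finset.smul_sum] at ha
  simp only [smul_smul] at ha
  exact congrFun (gradField_coeff_unique H.le (hθ x hx) ha) j

/-- All coefficients obey the same transport equations, so one exponential carries them from the
base slice of a chart. What remains is a function of `σ`, which is invariant under every element of
`G`, not only those near the identity. Positivity of the factor is used later for averaging. -/
theorem exists_local_factor (hV : IsOpen V) (hθ : ∀ x ∈ V, theta S B σ x ≠ 0)
    (hβ : ∀ j, AnalyticOnNhd ℝ (β j) V) (hsym : OrbitallySymmetricOn G V (gradPart S σ β))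
    {x₀ : Fin n → ℝ} (hx₀ : x₀ ∈ V) :
    ∃ W : Set (Fin n → ℝ), IsOpen W ∧ x₀ ∈ W ∧ W ⊆ V ∧
      ∃ (ν : (Fin n → ℝ) → ℝ) (β' : Fin (n - s) → (Fin n → ℝ) → ℝ),
        AnalyticOnNhd ℝ ν W ∧ (∀ x ∈ W, 0 < ν x) ∧
        ∀ j, AnalyticOnNhd ℝ (β' j) W ∧ InvariantOn G W (β' j) ∧
          ∀ x ∈ W, β j x = ν x * β' j x := by
  obtain ⟨c, hcV⟩ := H.exists_fibreChart hV hx₀ (hθ x₀ hx₀)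
  choose a ha haβ using fun i => hsym (B i) (H.mem_lieAlg i)
  obtain ⟨A, hA, htr⟩ := H.exists_transport c (fun x hx => hθ x (hcV hx))
    (a := a) fun i => (ha i).mono hcV
  have hmem : ∀ x ∈ c.N, (polyMap σ x, c.ℓ x₀) ∈ Metric.ball (polyMap σ x₀, c.ℓ x₀) c.δ := by
    intro x hx
    have := c.mem_ball x hx
    rw [Metric.mem_ball, Prod.dist_eq, max_lt_iff] at this ⊢
    exact ⟨this.1, by simpa using c.δ_pos⟩
  refine ⟨c.N, c.isOpen_N, c.mem_N, hcV, fun x => Real.exp (A (polyMap σ x, c.ℓ x)),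
    fun j x => β j (c.ψ (polyMap σ x, c.ℓ x₀)), fun x hx => ?_, fun x _ => Real.exp_pos _,
    fun j => ⟨fun x hx => ?_, fun g hg x hx hgx => ?_, fun x hx => ?_⟩⟩
  · exact ((hA _ (c.mem_ball x hx)).comp_of_eq
      ((analyticAt_polyMap σ x).prod (c.ℓ.analyticAt x)) rfl).rexp
  · exact (hβ j _ (hcV (c.mapsTo (hmem x hx)))).comp_of_eq ((c.analytic _ (hmem x hx)).comp_of_eq
      ((analyticAt_polyMap σ x).prod analyticAt_const) rfl) rfl
  · simp only
    rw [polyMap_invariant H.invariant hg]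
  · have h1 := htr (β j) (fun y hy => (hβ j y (hcV hy)).differentiableAt)
      (fun y hy i => H.fderiv_coeff_of_orbitallySymmetricOn hθ hβ (H.mem_lieAlg i) (hcV hy)
        (haβ i y (hcV hy)) j) _ (c.mem_ball x hx)
    rwa [c.ψ_eq x hx] at h1

/-- The local functions are determined where `gradPart` is nonzero and, by continuity, on the
closure of that set, so they glue there. Off the closure the field vanishes and the value `0`
serves. -/
theorem orbitallySymmetricOn_of_local (hV : IsOpen V) (hβ : ∀ j, AnalyticOnNhd ℝ (β j) V)
    (hloc : ∀ x ∈ V, ∃ W : Set (Fin n → ℝ), IsOpen W ∧ x ∈ W ∧ W ⊆ V ∧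
      InvariantUpToFactorOn G W β) : OrbitallySymmetricOn G V (gradPart S σ β) := by
  classical
  intro B' hB'
  have h1 : ∀ x ∈ V, ∃ a : (Fin n → ℝ) → ℝ, ∀ᶠ y in 𝓝 x, AnalyticAt ℝ a y ∧
      VectorField.lieBracket ℝ (linField B') (gradPart S σ β) y = a y • gradPart S σ β y := by
    intro x hx
    obtain ⟨W, hW, hxW, hWV, h⟩ := hloc x hx
    obtain ⟨a, ha, hab⟩ := H.orbitallySymmetricOn_of_invariantUpToFactorOn hW h B' hB'
    refine ⟨a, ?_⟩
    filter_upwards [hW.mem_nhds hxW] with y hy using ⟨ha y hy, hab y hy⟩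
  choose! a ha using h1
  set D : Set (Fin n → ℝ) := {x ∈ V | gradPart S σ β x ≠ 0} with hD
  refine ⟨fun x => if x ∈ closure D then a x x else 0, fun x hx => ?_, fun x hx => ?_⟩
  · by_cases hxD : x ∈ closure D
    · refine (ha x hx).self_of_nhds.1.congr ?_
      filter_upwards [hV.mem_nhds hx, (ha x hx).eventually_nhds,
        eventually_mem_closure_support hV (analyticOnNhd_gradPart hβ) hx hxD] with y hy hay hyD
      rw [if_pos hyD]
      refine eq_of_mem_closure_of_eventually hyD hay.self_of_nhds.1.continuousAt
        (ha y hy).self_of_nhds.1.continuousAt ?_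
      filter_upwards [hay, ha y hy] with z hz hz' hzD
      exact smul_left_injective ℝ hzD.2 (hz.2.symm.trans hz'.2)
    · refine (analyticAt_const (v := (0 : ℝ))).congr ?_
      filter_upwards [isClosed_closure.isOpen_compl.mem_nhds hxD] with y hy
      rw [if_neg hy]
  · have h2 := (ha x hx).self_of_nhds.2
    by_cases hxD : x ∈ closure D
    · simp only [if_pos hxD]; exact h2
    · have h0 : gradPart S σ β x = 0 := by
        by_contra hne
        exact hxD (subset_closure ⟨hx, hne⟩)
      rw [h2, h0, smul_zero, smul_zero]

end IsOrbitFrame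

/-! ### Multipliers along the group action -/

/-- The entries of an element of a linear group. -/
def entries (g : G) : Fin n → Fin n → ℝ :=
  fun i j => ((g : GL (Fin n) ℝ) : Matrix (Fin n) (Fin n) ℝ) i j

theorem continuous_entries : Continuous (entries : G → Fin n → Fin n → ℝ) :=
  continuous_pi fun i => continuous_pi fun j => continuous_entry G i j

theorem analyticAt_fst_entry {E : Type*} [NormedAddCommGroup E] [NormedSpace ℝ E] (i j : Fin n)
    (p : (Fin n → Fin n → ℝ) × E) :
    AnalyticAt ℝ (fun p : (Fin n → Fin n → ℝ) × E => p.1 i j) p :=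
  (((ContinuousLinearMap.proj (R := ℝ) (φ := fun _ : Fin n => ℝ) j).comp
    (ContinuousLinearMap.proj (R := ℝ) (φ := fun _ : Fin n => Fin n → ℝ) i)).analyticAt
      p.1).comp_of_eq analyticAt_fst rfl

/-- Near `(g₀, x₀)` the action of `G` multiplies the family `β` by a positive analytic factor. -/
def HasMultiplier {k : ℕ} (β : Fin k → (Fin n → ℝ) → ℝ) (g₀ : G) (x₀ : Fin n → ℝ)
    (Φ : (Fin n → Fin n → ℝ) × (Fin n → ℝ) → ℝ) : Prop :=
  AnalyticAt ℝ Φ (entries g₀, x₀) ∧ 0 < Φ (entries g₀, x₀) ∧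
    ∀ᶠ q : G × (Fin n → ℝ) in 𝓝 (g₀, x₀), ∀ j,
      β j (((q.1 : GL (Fin n) ℝ) : Matrix (Fin n) (Fin n) ℝ) *ᵥ q.2) =
        Φ (entries q.1, q.2) * β j q.2

section Multiplier

variable {k : ℕ} {γ : Fin k → (Fin n → ℝ) → ℝ} {g₀ : G} {x₀ : Fin n → ℝ}
  {Φ : (Fin n → Fin n → ℝ) × (Fin n → ℝ) → ℝ}

theorem HasMultiplier.eventually (h : HasMultiplier γ g₀ x₀ Φ) :
    ∀ᶠ q : G × (Fin n → ℝ) in 𝓝 (g₀, x₀), HasMultiplier γ q.1 q.2 Φ := by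
  obtain ⟨h1, h2, h3⟩ := h
  have hc : ContinuousAt (fun q : G × (Fin n → ℝ) => (entries q.1, q.2)) (g₀, x₀) :=
    ((continuous_entries.comp continuous_fst).prodMk continuous_snd).continuousAt
  filter_upwards [hc.eventually h1.eventually_analyticAt,
    hc.eventually (h1.continuousAt.eventually_const_lt h2), h3.eventually_nhds] with q q1 q2 q3
  exact ⟨q1, q2, q3⟩

theorem HasMultiplier.eq (h : HasMultiplier γ g₀ x₀ Φ) (j : Fin k) :
    γ j (((g₀ : GL (Fin n) ℝ) : Matrix (Fin n) (Fin n) ℝ) *ᵥ x₀) =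
      Φ (entries g₀, x₀) * γ j x₀ :=
  h.2.2.self_of_nhds j

/-- Near `h₀ * g₀` write `g = (g * g₀⁻¹) * g₀`: the second factor is fixed, and the first is close
to `h₀`. The map `T` is this substitution on matrix entries, so the product is analytic on the
ambient matrix space. -/
theorem HasMultiplier.mul {h₀ : G} {Ψ : (Fin n → Fin n → ℝ) × (Fin n → ℝ) → ℝ}
    (hh : HasMultiplier γ h₀ (((g₀ : GL (Fin n) ℝ) : Matrix (Fin n) (Fin n) ℝ) *ᵥ x₀) Ψ)
    (hg : HasMultiplier γ g₀ x₀ Φ) : ∃ Φ', HasMultiplier γ (h₀ * g₀) x₀ Φ' := by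
  let T : (Fin n → Fin n → ℝ) × (Fin n → ℝ) → (Fin n → Fin n → ℝ) × (Fin n → ℝ) := fun p =>
    (fun i j => ∑ l, p.1 i l * entries g₀⁻¹ l j,
      linField ((g₀ : GL (Fin n) ℝ) : Matrix (Fin n) (Fin n) ℝ) p.2)
  have hT : ∀ (g : G) (x : Fin n → ℝ), T (entries g, x) =
      (entries (g * g₀⁻¹), ((g₀ : GL (Fin n) ℝ) : Matrix (Fin n) (Fin n) ℝ) *ᵥ x) := by
    intro g x
    refine Prod.ext ?_ rfl
    funext i j
    simp only [T, entries, Subgroup.coe_mul, Units.val_mul, Matrix.mul_apply]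
  have hTan : ∀ p, AnalyticAt ℝ T p := fun p => by
    refine AnalyticAt.prod ?_ ((analyticAt_linField _ _).comp analyticAt_snd)
    refine AnalyticAt.pi fun i => AnalyticAt.pi fun j => Finset.analyticAt_fun_sum _ fun l _ => ?_
    refine AnalyticAt.mul ?_ analyticAt_const
    exact analyticAt_fst_entry i l _
  have hT0 : T (entries (h₀ * g₀), x₀) =
      (entries h₀, ((g₀ : GL (Fin n) ℝ) : Matrix (Fin n) (Fin n) ℝ) *ᵥ x₀) := by
    rw [hT, mul_inv_cancel_right]
  have hg' : AnalyticAt ℝ (fun p : (Fin n → Fin n → ℝ) × (Fin n → ℝ) => Φ (entries g₀, p.2))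
      (entries (h₀ * g₀), x₀) :=
    hg.1.comp_of_eq (analyticAt_const.prod analyticAt_snd) rfl
  refine ⟨fun p => Ψ (T p) * Φ (entries g₀, p.2), (hh.1.comp_of_eq (hTan _) hT0).mul hg', ?_, ?_⟩
  · simp only [hT0]
    exact mul_pos hh.2.1 hg.2.1
  · have c1 : Tendsto (fun q : G × (Fin n → ℝ) =>
        (q.1 * g₀⁻¹, ((g₀ : GL (Fin n) ℝ) : Matrix (Fin n) (Fin n) ℝ) *ᵥ q.2)) (𝓝 (h₀ * g₀, x₀))
        (𝓝 (h₀, ((g₀ : GL (Fin n) ℝ) : Matrix (Fin n) (Fin n) ℝ) *ᵥ x₀)) := by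
      have : Continuous (fun q : G × (Fin n → ℝ) =>
          (q.1 * g₀⁻¹, ((g₀ : GL (Fin n) ℝ) : Matrix (Fin n) (Fin n) ℝ) *ᵥ q.2)) :=
        (continuous_fst.mul continuous_const).prodMk
          ((continuous_action G).comp (continuous_const.prodMk continuous_snd))
      have h := this.tendsto (h₀ * g₀, x₀)
      simp only [mul_inv_cancel_right] at h
      exact h
    have c2 : Tendsto (fun q : G × (Fin n → ℝ) => (g₀, q.2)) (𝓝 (h₀ * g₀, x₀)) (𝓝 (g₀, x₀)) :=
      (continuous_const.prodMk continuous_snd).tendsto (h₀ * g₀, x₀)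
    filter_upwards [c1.eventually hh.2.2, c2.eventually hg.2.2] with q q1 q2 j
    have e1 := q1 j
    have e2 := q2 j
    rw [← mul_action_eq, inv_mul_cancel_right, e2] at e1
    rw [e1, hT, mul_assoc]

/-- The multiplier is `ν (g x) / ν x`, which makes sense as long as `g x` stays in `W`. -/
theorem exists_hasMultiplier_one {W : Set (Fin n → ℝ)} (hW : IsOpen W) (hx₀ : x₀ ∈ W)
    {ν : (Fin n → ℝ) → ℝ} {γ' : Fin k → (Fin n → ℝ) → ℝ} (hν : AnalyticOnNhd ℝ ν W)
    (hν0 : ∀ x ∈ W, 0 < ν x) (hγ' : ∀ j, InvariantOn G W (γ' j))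
    (hγ : ∀ j, ∀ x ∈ W, γ j x = ν x * γ' j x) : ∃ Φ, HasMultiplier γ (1 : G) x₀ Φ := by
  let act : (Fin n → Fin n → ℝ) × (Fin n → ℝ) → Fin n → ℝ := fun p i => ∑ l, p.1 i l * p.2 l
  have hact : ∀ (g : G) (x : Fin n → ℝ),
      act (entries g, x) = ((g : GL (Fin n) ℝ) : Matrix (Fin n) (Fin n) ℝ) *ᵥ x := fun g x => rfl
  have hactan : ∀ p, AnalyticAt ℝ act p := fun p => by
    refine AnalyticAt.pi fun i => Finset.analyticAt_fun_sum _ fun l _ => AnalyticAt.mul ?_ ?_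
    · exact analyticAt_fst_entry i l _
    · exact (analyticAt_pi_iff.1 analyticAt_snd) l
  have hact1 : act (entries (1 : G), x₀) = x₀ := by rw [hact, one_action_eq]
  refine ⟨fun p => ν (act p) / ν p.2, ?_, ?_, ?_⟩
  · exact ((hν _ hx₀).comp_of_eq (hactan _) hact1).div ((hν _ hx₀).comp_of_eq analyticAt_snd rfl)
      (hν0 _ hx₀).ne'
  · simp only [hact1]
    exact div_pos (hν0 _ hx₀) (hν0 _ hx₀)
  · have c1 : ∀ᶠ q : G × (Fin n → ℝ) in 𝓝 (1, x₀),
        ((q.1 : GL (Fin n) ℝ) : Matrix (Fin n) (Fin n) ℝ) *ᵥ q.2 ∈ W :=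
      (continuous_action G).continuousAt.eventually_mem
        (by rw [one_action_eq]; exact hW.mem_nhds hx₀)
    have c2 : ∀ᶠ q : G × (Fin n → ℝ) in 𝓝 (1, x₀), q.2 ∈ W :=
      continuous_snd.continuousAt.eventually_mem (hW.mem_nhds hx₀)
    filter_upwards [c1, c2] with q q1 q2 j
    rw [hact, hγ j _ q1, hγ j _ q2, hγ' j _ q.1.2 _ q2 q1]
    have := (hν0 _ q2).ne'
    field_simp

/-- The group elements having a multiplier at `x` form an open and closed set containing `1`. For
closedness, if `h` is close to `g`, then `g * h⁻¹` is close to `1` and has a multiplier at `h x`, so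
a multiplier of `h` yields one of `g`. Stability of `V` puts `g x` back in `V`. -/
theorem exists_hasMultiplier [ConnectedSpace G] {V : Set (Fin n → ℝ)} (hst : StableSet G V)
    (h1 : ∀ x ∈ V, ∃ Φ, HasMultiplier γ (1 : G) x Φ) (g : G) {x : Fin n → ℝ} (hx : x ∈ V) :
    ∃ Φ, HasMultiplier γ g x Φ := by
  let A : Set G := {g | ∃ Φ, HasMultiplier γ g x Φ}
  have hmk : ∀ g : G, Continuous fun h : G => (h, x) := fun g =>
    continuous_id.prodMk continuous_const
  have hAo : IsOpen A := by
    rw [isOpen_iff_mem_nhds]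
    rintro g ⟨Φ, hΦ⟩
    filter_upwards [(hmk g).continuousAt.eventually hΦ.eventually] with h hh using ⟨Φ, hh⟩
  have hAc : IsClosed A := by
    rw [← isOpen_compl_iff, isOpen_iff_mem_nhds]
    intro g hg
    obtain ⟨Φ, hΦ⟩ := h1 _ (hst g g.2 x hx)
    have hc : Tendsto (fun h : G => (g * h⁻¹,
        ((h : GL (Fin n) ℝ) : Matrix (Fin n) (Fin n) ℝ) *ᵥ x)) (𝓝 g)
        (𝓝 (1, ((g : GL (Fin n) ℝ) : Matrix (Fin n) (Fin n) ℝ) *ᵥ x)) := by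
      have : Continuous fun h : G => (g * h⁻¹,
          ((h : GL (Fin n) ℝ) : Matrix (Fin n) (Fin n) ℝ) *ᵥ x) :=
        (continuous_const.mul continuous_inv).prodMk
          ((continuous_action G).comp (continuous_id.prodMk continuous_const))
      have h := this.tendsto g
      simp only [mul_inv_cancel] at h
      exact h
    filter_upwards [hc.eventually hΦ.eventually] with h hh
    rintro ⟨Ψ, hΨ⟩
    obtain ⟨Φ', hΦ'⟩ := HasMultiplier.mul hh hΨ
    rw [inv_mul_cancel_right] at hΦ'
    exact hg ⟨Φ', hΦ'⟩
  have hA : A = Set.univ := IsClopen.eq_univ ⟨hAc, hAo⟩ ⟨1, h1 x hx⟩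
  exact (hA ▸ Set.mem_univ g : g ∈ A)

end Multiplier

/-- Averaging the multipliers over the group yields invariance up to a global factor. -/
theorem invariantUpToFactorOn_of_multipliers {k : ℕ} (hG : IsCompact (G : Set (GL (Fin n) ℝ)))
    {V : Set (Fin n → ℝ)} (hV : IsOpen V)
    {β : Fin k → (Fin n → ℝ) → ℝ} (hβ : ∀ j, AnalyticOnNhd ℝ (β j) V)
    (hmul : ∀ (g : G), ∀ x ∈ V, ∃ Φ, HasMultiplier β g x Φ) : InvariantUpToFactorOn G V β := by
  classical
  have : CompactSpace G := isCompact_iff_compactSpace.1 hG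
  let _ : MeasurableSpace G := borel G
  have : BorelSpace G := ⟨rfl⟩
  choose! Φ hΦ using hmul
  set D : Set (Fin n → ℝ) := {x ∈ V | (fun j => β j x) ≠ 0} with hD
  have hβan : AnalyticOnNhd ℝ (fun x => fun j => β j x) V := fun x hx =>
    AnalyticAt.pi fun j => hβ j x hx
  -- The values of the multipliers are unique only over the closure of the set where some `β j` is
  -- nonzero; elsewhere all `β j` vanish and `1` is taken.
  let χ : G → (Fin n → ℝ) → ℝ := fun g x => if x ∈ closure D then Φ g x (entries g, x) else 1
  have hχ : ∀ g : G, ∀ x ∈ V, x ∈ closure D → ∀ j,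
      β j (((g : GL (Fin n) ℝ) : Matrix (Fin n) (Fin n) ℝ) *ᵥ x) = χ g x * β j x := by
    intro g x hx hxD j
    simp only [χ, if_pos hxD]
    exact (hΦ g x hx).eq j
  have hχpos : ∀ g : G, ∀ x ∈ V, 0 < χ g x := by
    intro g x hx
    simp only [χ]
    split_ifs
    · exact (hΦ g x hx).2.1
    · exact one_pos
  -- The chosen functions `Φ g x` vary with the point. Near `(g₀, x₀)` they agree with a single one,
  -- because they coincide where some `β j` is nonzero and hence, by continuity, on its closure.
  have hχloc : ∀ g₀ : G, ∀ x₀ ∈ V, ∃ F : (Fin n → Fin n → ℝ) × (Fin n → ℝ) → ℝ,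
      AnalyticAt ℝ F (entries g₀, x₀) ∧
        ∀ᶠ q : G × (Fin n → ℝ) in 𝓝 (g₀, x₀), χ q.1 q.2 = F (entries q.1, q.2) := by
    intro g₀ x₀ hx₀
    by_cases hxD : x₀ ∈ closure D
    · refine ⟨Φ g₀ x₀, (hΦ g₀ x₀ hx₀).1, ?_⟩
      have hsnd : Tendsto (Prod.snd : G × (Fin n → ℝ) → _) (𝓝 (g₀, x₀)) (𝓝 x₀) :=
        continuous_snd.tendsto (g₀, x₀)
      filter_upwards [(hΦ g₀ x₀ hx₀).eventually, hsnd.eventually (hV.mem_nhds hx₀),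
        hsnd.eventually (eventually_mem_closure_support hV hβan hx₀ hxD)] with q hq hqV hqD
      have hqD' : q.2 ∈ closure D := hqD
      simp only [χ, if_pos hqD']
      have hmk : ContinuousAt (fun y : Fin n → ℝ => (q.1, y)) q.2 := by fun_prop
      have hmk' : ContinuousAt (fun y : Fin n → ℝ => (entries q.1, y)) q.2 := by fun_prop
      refine eq_of_mem_closure_of_eventually hqD
        (u := fun y => Φ q.1 q.2 (entries q.1, y)) (v := fun y => Φ g₀ x₀ (entries q.1, y))
        (ContinuousAt.comp (f := fun y : Fin n → ℝ => (entries q.1, y))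
          (hΦ q.1 q.2 hqV).1.continuousAt hmk')
        (ContinuousAt.comp (f := fun y : Fin n → ℝ => (entries q.1, y)) hq.1.continuousAt hmk') ?_
      filter_upwards [hmk.eventually (hΦ q.1 q.2 hqV).2.2, hmk.eventually hq.2.2]
        with y hy hy' hyD
      obtain ⟨j, hj⟩ := Function.ne_iff.1 hyD.2
      exact mul_right_cancel₀ hj ((hy j).symm.trans (hy' j))
    · refine ⟨fun _ => 1, analyticAt_const, ?_⟩
      have : ∀ᶠ q : G × (Fin n → ℝ) in 𝓝 (g₀, x₀), q.2 ∈ (closure D)ᶜ :=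
        continuous_snd.continuousAt.eventually_mem
          (isClosed_closure.isOpen_compl.mem_nhds hxD)
      filter_upwards [this] with q hq
      exact if_neg hq
  -- The cocycle identity and left invariance of the measure give `N (h x) * χ h x = N x` where the
  -- `β j` do not all vanish, so `N * β j` is invariant there. The inverse in the integrand turns
  -- right translation by `h` into left translation.
  let N : (Fin n → ℝ) → ℝ := fun x => ∫ g : G, χ g⁻¹ x ∂probHaar G
  have hN : ∀ x ∈ V, AnalyticAt ℝ N x ∧ Integrable (fun g : G => χ g⁻¹ x) (probHaar G) := by
    intro x hx
    have h := analyticAt_setIntegral (μ := probHaar G) (e := fun g : G => entries g⁻¹)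
      (continuous_entries.comp continuous_inv) (f := fun g x => χ g⁻¹ x) (x₀ := x)
      isCompact_univ MeasurableSet.univ fun g _ => by
        obtain ⟨F, hF, hFχ⟩ := hχloc g⁻¹ x hx
        have hc : Continuous fun q : G × (Fin n → ℝ) => (q.1⁻¹, q.2) := by fun_prop
        exact ⟨F, hF, (hc.tendsto (g, x)).eventually hFχ⟩
    rw [integrableOn_univ] at h
    simpa only [Measure.restrict_univ] using h
  have hNpos : ∀ x ∈ V, 0 < N x := by
    intro x hx
    have hsupp : Function.support (fun g : G => χ g⁻¹ x) = Set.univ :=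
      Set.eq_univ_of_forall fun g => (hχpos g⁻¹ x hx).ne'
    refine (integral_pos_iff_support_of_nonneg (fun g => (hχpos g⁻¹ x hx).le) (hN x hx).2).2 ?_
    rw [hsupp, measure_univ]
    exact one_pos
  refine ⟨fun x => (N x)⁻¹, fun j x => N x * β j x, fun x hx => (hN x hx).1.inv (hNpos x hx).ne',
    fun x hx => inv_ne_zero (hNpos x hx).ne', fun j => ⟨fun x hx => (hN x hx).1.mul (hβ j x hx),
      fun h hh x hx hhx => ?_, fun x hx => by rw [inv_mul_cancel_left₀ (hNpos x hx).ne']⟩⟩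
  simp only
  by_cases hx0 : (fun j => β j x) = 0
  · have h1 : ∀ j, β j x = 0 := fun j => congrFun hx0 j
    rw [show β j ((h : Matrix (Fin n) (Fin n) ℝ) *ᵥ x) = _ from (hΦ ⟨h, hh⟩ x hx).eq j, h1]
    simp
  · have hxD : x ∈ D := ⟨hx, hx0⟩
    obtain ⟨l, hl⟩ := Function.ne_iff.1 hx0
    have hl' : β l x ≠ 0 := hl
    have hhl : β l ((h : Matrix (Fin n) (Fin n) ℝ) *ᵥ x) = χ ⟨h, hh⟩ x * β l x :=
      hχ ⟨h, hh⟩ x hx (subset_closure hxD) l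
    have hhD : (h : Matrix (Fin n) (Fin n) ℝ) *ᵥ x ∈ D := by
      refine ⟨hhx, fun h0 => ?_⟩
      have h2 : β l ((h : Matrix (Fin n) (Fin n) ℝ) *ᵥ x) = 0 := congrFun h0 l
      rw [hhl] at h2
      exact mul_ne_zero (hχpos _ x hx).ne' hl' h2
    -- The cocycle identity is obtained by moving `x` first by `h` and then by `g⁻¹`, and cancelling
    -- the nonzero value `β l x`.
    have hcoc : ∀ g : G, χ g⁻¹ ((h : Matrix (Fin n) (Fin n) ℝ) *ᵥ x) * χ ⟨h, hh⟩ x =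
        χ ((⟨h, hh⟩ : G)⁻¹ * g)⁻¹ x := by
      intro g
      have e1 := hχ g⁻¹ _ hhx (subset_closure hhD) l
      have e2 := hχ ((⟨h, hh⟩ : G)⁻¹ * g)⁻¹ x hx (subset_closure hxD) l
      rw [_root_.mul_inv_rev, inv_inv, mul_action_eq] at e2
      rw [hhl] at e1
      have e3 := e1.symm.trans e2
      rw [← mul_assoc] at e3
      rw [_root_.mul_inv_rev, inv_inv]
      exact mul_right_cancel₀ hl' e3
    have hNh : N ((h : Matrix (Fin n) (Fin n) ℝ) *ᵥ x) * χ ⟨h, hh⟩ x = N x := by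
      simp only [N]
      rw [← integral_mul_const]
      simp only [hcoc]
      exact integral_mul_left_eq_self (fun g : G => χ g⁻¹ x) (⟨h, hh⟩ : G)⁻¹
    rw [hχ ⟨h, hh⟩ x hx (subset_closure hxD) j, ← mul_assoc, hNh]

end

end OrbitalReduction

end

theorem mainTheorem4 {n s r : ℕ}
    -- a compact connected linear group with an invariant scalar product
    (G : Subgroup (GL (Fin n) ℝ))
    (hGcompact : IsCompact (G : Set (GL (Fin n) ℝ)))
    (hGconn : IsConnected (G : Set (GL (Fin n) ℝ)))
    (S : Matrix (Fin n) (Fin n) ℝ)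
    (hS : OrbitalReduction.IsInvariantScalarProduct G S)
    -- the maximal orbit dimension is `s`, and it is positive
    (hs : IsGreatest (Set.range (OrbitalReduction.orbitDim G)) s)
    (hs0 : 0 < s)
    (B : Fin s → Matrix (Fin n) (Fin n) ℝ)
    (hB : ∀ i, B i ∈ OrbitalReduction.lieAlg G)
    (hBind : ∃ z : Fin n → ℝ, LinearIndependent ℝ (fun i => OrbitalReduction.linField (B i) z))
    -- algebraically independent polynomial invariants
    (σ : Fin (n - s) → MvPolynomial (Fin n) ℝ)
    (hσ : ∀ j, σ j ∈ OrbitalReduction.invariantAlgebra G)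
    (hσind : AlgebraicIndependent ℝ σ)
    -- a finite system of generators of the algebra of polynomial invariants
    (τ : Fin r → MvPolynomial (Fin n) ℝ)
    (hτ : Algebra.adjoin ℝ (Set.range τ) = OrbitalReduction.invariantAlgebra G)
    -- an analytic vector field on `U` and its representation on `{x ∈ U | θ x ≠ 0}`
    (U : Set (Fin n → ℝ)) (hU : IsOpen U)
    (f : (Fin n → ℝ) → (Fin n → ℝ)) (hf : AnalyticOnNhd ℝ f U)
    (α : Fin s → (Fin n → ℝ) → ℝ) (β : Fin (n - s) → (Fin n → ℝ) → ℝ)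
    (hrep : ∀ x ∈ U, OrbitalReduction.theta S B σ x ≠ 0 →
      f x = ∑ i, α i x • OrbitalReduction.linField (B i) x +
        ∑ j, β j x • OrbitalReduction.gradField S (σ j) x)
    -- a nonempty open subset `V` of `{x ∈ U | θ x ≠ 0}`
    (V : Set (Fin n → ℝ)) (hV : IsOpen V) (hVne : V.Nonempty)
    (hVU : V ⊆ {x ∈ U | OrbitalReduction.theta S B σ x ≠ 0}) :
    -- (a)
    ((OrbitalReduction.ReducibleBy (OrbitalReduction.polyMap τ) f V ↔
        ∀ j, OrbitalReduction.InvariantOn G V (β j)) ∧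
      ((∀ j, OrbitalReduction.InvariantOn G V (β j)) ↔
        OrbitalReduction.SymmetricOn G V
          (fun x => ∑ j, β j x • OrbitalReduction.gradField S (σ j) x)) ∧
      (OrbitalReduction.ReducibleBy (OrbitalReduction.polyMap τ) f V →
        OrbitalReduction.InvolutionSystemOn (fun i => OrbitalReduction.linField (B i)) V ∧
        ∃ (F : (Fin n → ℝ) → (Fin n → ℝ)) (μ : Fin s → (Fin n → ℝ) → ℝ),
          AnalyticOnNhd ℝ F V ∧ OrbitalReduction.SymmetricOn G V F ∧
          (∀ i, ∀ x ∈ V, VectorField.lieBracket ℝ F (OrbitalReduction.linField (B i)) x = 0) ∧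
          (∀ i, AnalyticOnNhd ℝ (μ i) V) ∧
          ∀ x ∈ V, f x = F x + ∑ i, μ i x • OrbitalReduction.linField (B i) x)) ∧
    -- (b)
    ((OrbitalReduction.OrbitallyReducibleBy (OrbitalReduction.polyMap τ) f V ↔
        OrbitalReduction.InvariantUpToFactorOn G V β) ∧
      (OrbitalReduction.InvariantUpToFactorOn G V β →
        OrbitalReduction.OrbitallySymmetricOn G V
          (fun x => ∑ j, β j x • OrbitalReduction.gradField S (σ j) x)) ∧
      -- the reverse implication holds on `V` if `V` is `G`-stable ...
      (OrbitalReduction.StableSet G V →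
        OrbitalReduction.OrbitallySymmetricOn G V
          (fun x => ∑ j, β j x • OrbitalReduction.gradField S (σ j) x) →
        OrbitalReduction.InvariantUpToFactorOn G V β) ∧
      -- ... and locally for every `V`
      ((∀ x ∈ V, ∃ W : Set (Fin n → ℝ), IsOpen W ∧ x ∈ W ∧ W ⊆ V ∧
          OrbitalReduction.InvariantUpToFactorOn G W β) ↔
        OrbitalReduction.OrbitallySymmetricOn G V
          (fun x => ∑ j, β j x • OrbitalReduction.gradField S (σ j) x)) ∧
      ((∀ x ∈ V, ∃ W : Set (Fin n → ℝ), IsOpen W ∧ x ∈ W ∧ W ⊆ V ∧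
          OrbitalReduction.OrbitallyReducibleBy (OrbitalReduction.polyMap τ) f W) ↔
        OrbitalReduction.OrbitallySymmetricOn G V
          (fun x => ∑ j, β j x • OrbitalReduction.gradField S (σ j) x)) ∧
      (OrbitalReduction.OrbitallyReducibleBy (OrbitalReduction.polyMap τ) f V →
        OrbitalReduction.InvolutionSystemOn (fun i => OrbitalReduction.linField (B i)) V ∧
        ∃ (F : (Fin n → ℝ) → (Fin n → ℝ)) (a μ : Fin s → (Fin n → ℝ) → ℝ),
          AnalyticOnNhd ℝ F V ∧ OrbitalReduction.OrbitallySymmetricOn G V F ∧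
          (∀ i, AnalyticOnNhd ℝ (a i) V) ∧
          (∀ i, ∀ x ∈ V,
            VectorField.lieBracket ℝ F (OrbitalReduction.linField (B i)) x = a i x • F x) ∧
          (∀ i, AnalyticOnNhd ℝ (μ i) V) ∧
          ∀ x ∈ V, f x = F x + ∑ i, μ i x • OrbitalReduction.linField (B i) x)) := by
  have hsn : s ≤ n := by
    obtain ⟨z, hz⟩ := hBind
    simpa using hz.fintype_card_le_finrank
  have H : OrbitalReduction.IsOrbitFrame G S B σ := ⟨hsn, hS, hB, hσ⟩
  have hθ : ∀ x ∈ V, OrbitalReduction.theta S B σ x ≠ 0 := fun x hx => (hVU hx).2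
  have hfV : AnalyticOnNhd ℝ f V := hf.mono fun x hx => (hVU hx).1
  have hrepV : ∀ x ∈ V, f x = ∑ i, α i x • OrbitalReduction.linField (B i) x +
      OrbitalReduction.gradPart S σ β x := fun x hx => hrep x (hVU hx).1 (hVU hx).2
  obtain ⟨hα, hβ⟩ := H.analyticOnNhd_coeff hV hθ hfV hrepV
  have hred := H.reducibleBy_iff hGcompact hs0 hτ hV hVne hθ hfV hrepV
  have hsymm := H.symmetricOn_iff hV hθ hβ
  have horb : ∀ W : Set (Fin n → ℝ), IsOpen W → W.Nonempty → W ⊆ V →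
      (OrbitalReduction.OrbitallyReducibleBy (OrbitalReduction.polyMap τ) f W ↔
        OrbitalReduction.InvariantUpToFactorOn G W β) := fun W hW hWne hWV =>
    H.orbitallyReducibleBy_iff hGcompact hs0 hτ hW hWne (fun x hx => hθ x (hWV hx))
      (hfV.mono hWV) fun x hx => hrepV x (hWV hx)
  have hinvol := H.involutionSystemOn hV hθ
  have hF := OrbitalReduction.analyticOnNhd_gradPart (S := S) (σ := σ) hβ
  have hfac := H.orbitallySymmetricOn_of_invariantUpToFactorOn (β := β) hV
  have hloc : (∀ x ∈ V, ∃ W : Set (Fin n → ℝ), IsOpen W ∧ x ∈ W ∧ W ⊆ V ∧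
      OrbitalReduction.InvariantUpToFactorOn G W β) ↔
        OrbitalReduction.OrbitallySymmetricOn G V (OrbitalReduction.gradPart S σ β) := by
    refine ⟨H.orbitallySymmetricOn_of_local hV hβ, fun hsym x hx => ?_⟩
    obtain ⟨W, hW, hxW, hWV, ν, β', hν, hν0, hβ'⟩ := H.exists_local_factor hV hθ hβ hsym hx
    exact ⟨W, hW, hxW, hWV, ν, β', hν, fun y hy => (hν0 y hy).ne', hβ'⟩
  -- The symmetric field is the gradient part of `f`, and the functions `μ i` are the orbit
  -- coefficients `α i`.
  refine ⟨⟨hred, hsymm, fun h => ⟨hinvol, OrbitalReduction.gradPart S σ β, α, hF,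
    hsymm.1 (hred.1 h), fun i x hx => H.lieBracket_gradPart_eq_zero hV hβ (hred.1 h) (hB i) hx, hα,
    fun x hx => by rw [hrepV x hx, add_comm]⟩⟩, horb V hV hVne subset_rfl, hfac, ?_, hloc, ?_, ?_⟩
  · intro hst hsym
    have : ConnectedSpace G := Subtype.connectedSpace hGconn
    refine OrbitalReduction.invariantUpToFactorOn_of_multipliers hGcompact hV hβ fun g x hx =>
      OrbitalReduction.exists_hasMultiplier hst (fun y hy => ?_) g hx
    obtain ⟨W, hW, hyW, -, ν, β', hν, hν0, hβ'⟩ := H.exists_local_factor hV hθ hβ hsym hy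
    exact OrbitalReduction.exists_hasMultiplier_one hW hyW hν hν0 (fun j => (hβ' j).2.1)
      fun j => (hβ' j).2.2
  · refine Iff.trans (forall₂_congr fun x hx => exists_congr fun W => ?_) hloc
    refine and_congr_right fun hW => and_congr_right fun hxW => and_congr_right fun hWV => ?_
    exact horb W hW ⟨x, hxW⟩ hWV
  · intro h
    have hsym := hfac ((horb V hV hVne subset_rfl).1 h)
    choose a ha haF using fun i => hsym (B i) (hB i)
    -- The sign comes from exchanging the two entries of the bracket.
    refine ⟨hinvol, OrbitalReduction.gradPart S σ β, fun i x => -a i x, α, hF, hsym,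
      fun i => (ha i).neg, fun i x hx => ?_, hα, fun x hx => by rw [hrepV x hx, add_comm]⟩
    rw [VectorField.lieBracket_swap, neg_smul]
    exact congrArg Neg.neg (haF i x hx)
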